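/- Let $f\colon\mathbb R^n\to\mathbb R^n$ and $h\colon\mathbb R^n\to\mathbb R^m$ be differentiable, and let $X_p\sim\mathcal N(m_p,P_p)$, $U\sim\mathcal N(0,\Sigma_U)$ (both in $\mathbb R^n$) and $V\sim\mathcal N(0,\Sigma_V)$ (in $\mathbb R^m$) be independent Gaussian random variables with positive-definite covariance matrices $P_p,\Sigma_U,\Sigma_V$. Put $X=f(X_p)+U$, $Y=h(X)+V$ and $Z=(X,Y)\in\mathbb R^{n+m}$. Let $J_f,J_h$ denote Jacobian matrices, $[J_g]_{ij}=\partial g_i/\partial x_j$, let expectations of random matrices be taken entrywise, and let $\le$ between matrices be the Löwner order ($A\le B$ iff $B-A$ is positive semidefinite). Set $$A_1=\begin{pmatrix}\mathbb E[J_f(X_p)]\\ \mathbb E[J_h(f(X_p)+U)J_f(X_p)]\end{pmatrix}P_p\begin{pmatrix}\mathbb E[J_f(X_p)]^{\mathsf T} & \mathbb E[J_h(f(X_p)+U)J_f(X_p)]^{\mathsf T}\end{pmatrix},$$ $$B_1=\begin{pmatrix}I_{n\times n}\\ \mathbb E[J_h(f(X_p)+U)]\end{pmatrix}\Sigma_U\begin{pmatrix}I_{n\times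 n} & \mathbb E[J_h(f(X_p)+U)]^{\mathsf T}\end{pmatrix},$$ $$A_2=\mathbb E\left[\begin{pmatrix}I_{n\times n}\\ J_h(f(X_p)+U)\end{pmatrix}\bigl[J_f(X_p)P_pJ_f(X_p)^{\mathsf T}+\Sigma_U\bigr]\begin{pmatrix}I_{n\times n} & J_h(f(X_p)+U)^{\mathsf T}\end{pmatrix}\right],\qquad C_V=\begin{pmatrix}0_{n\times n}&0_{n\times m}\\0_{m\times n}&\Sigma_V\end{pmatrix}.$$ If the expectation defining $A_2$ exists (all entries of the random matrix are integrable), then $Z$ is square integrable, the expectations in $A_1$ and $B_1$ exist, and $$A_1+B_1+C_V\le\operatorname{Cov}(Z)\le A_2+C_V.$$ Moreover, the lower bound $A_1+B_1+C_V\le\operatorname{Cov}(Z)$ holds already whenever $Z$ is square integrable and the expectations in $A_1$ and $B_1$ exist. -/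

import Mathlib

open MeasureTheory ProbabilityTheory
open scoped MatrixOrder

/-- The Jacobian matrix of `g` at `x`, with entries `∂ gᵢ / ∂ xⱼ`. -/
noncomputable def jacobian {a b : ℕ}
    (g : EuclideanSpace ℝ (Fin a) → EuclideanSpace ℝ (Fin b)) (x : EuclideanSpace ℝ (Fin a)) :
    Matrix (Fin b) (Fin a) ℝ :=
  Matrix.of fun i j => fderiv ℝ g x (EuclideanSpace.single j 1) i

/-- A random matrix has an expectation: every entry is integrable. -/
def HasExpectation {Ω ι κ : Type*} [MeasurableSpace Ω] (μ : Measure Ω)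
    (M : Ω → Matrix ι κ ℝ) : Prop :=
  ∀ i j, Integrable (fun ω => M ω i j) μ

/-- The (entrywise) expectation of a random matrix. -/
noncomputable def expectation {Ω ι κ : Type*} [MeasurableSpace Ω] (μ : Measure Ω)
    (M : Ω → Matrix ι κ ℝ) : Matrix ι κ ℝ :=
  Matrix.of fun i j => ∫ ω, M ω i j ∂μ

/-- The covariance matrix of a random vector. -/
noncomputable def covarianceMatrix {Ω ι : Type*} [MeasurableSpace Ω] (μ : Measure Ω)
    (Z : Ω → EuclideanSpace ℝ ι) : Matrix ι ι ℝ :=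
  Matrix.of fun i j => cov[fun ω => Z ω i, fun ω => Z ω j; μ]

/-- The state `X = f (Xₚ) + U`. -/
noncomputable def stateVar {Ω : Type*} {n : ℕ}
    (f : EuclideanSpace ℝ (Fin n) → EuclideanSpace ℝ (Fin n))
    (Xp U : Ω → EuclideanSpace ℝ (Fin n)) : Ω → EuclideanSpace ℝ (Fin n) :=
  fun ω => f (Xp ω) + U ω

/-- The measurement `Y = h (X) + V`. -/
noncomputable def measurementVar {Ω : Type*} {n m : ℕ}
    (f : EuclideanSpace ℝ (Fin n) → EuclideanSpace ℝ (Fin n))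
    (h : EuclideanSpace ℝ (Fin n) → EuclideanSpace ℝ (Fin m))
    (Xp U : Ω → EuclideanSpace ℝ (Fin n)) (V : Ω → EuclideanSpace ℝ (Fin m)) :
    Ω → EuclideanSpace ℝ (Fin m) :=
  fun ω => h (stateVar f Xp U ω) + V ω

/-- The joint variable `Z = (X, Y)`. -/
noncomputable def jointVar {Ω : Type*} {n m : ℕ}
    (f : EuclideanSpace ℝ (Fin n) → EuclideanSpace ℝ (Fin n))
    (h : EuclideanSpace ℝ (Fin n) → EuclideanSpace ℝ (Fin m))
    (Xp U : Ω → EuclideanSpace ℝ (Fin n)) (V : Ω → EuclideanSpace ℝ (Fin m)) :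
    Ω → EuclideanSpace ℝ (Fin n ⊕ Fin m) :=
  fun ω => WithLp.toLp 2
    (Sum.elim (fun i => stateVar f Xp U ω i) (fun j => measurementVar f h Xp U V ω j))

/-- The random matrix `J_f (Xₚ)`. -/
noncomputable def jacF {Ω : Type*} {n : ℕ}
    (f : EuclideanSpace ℝ (Fin n) → EuclideanSpace ℝ (Fin n))
    (Xp : Ω → EuclideanSpace ℝ (Fin n)) : Ω → Matrix (Fin n) (Fin n) ℝ :=
  fun ω => jacobian f (Xp ω)

/-- The random matrix `J_h [f (Xₚ) + U]`. -/
noncomputable def jacH {Ω : Type*} {n m : ℕ}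
    (f : EuclideanSpace ℝ (Fin n) → EuclideanSpace ℝ (Fin n))
    (h : EuclideanSpace ℝ (Fin n) → EuclideanSpace ℝ (Fin m))
    (Xp U : Ω → EuclideanSpace ℝ (Fin n)) : Ω → Matrix (Fin m) (Fin n) ℝ :=
  fun ω => jacobian h (f (Xp ω) + U ω)

/-- The random matrix `J_h [f (Xₚ) + U] J_f (Xₚ)`. -/
noncomputable def jacHF {Ω : Type*} {n m : ℕ}
    (f : EuclideanSpace ℝ (Fin n) → EuclideanSpace ℝ (Fin n))
    (h : EuclideanSpace ℝ (Fin n) → EuclideanSpace ℝ (Fin m))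
    (Xp U : Ω → EuclideanSpace ℝ (Fin n)) : Ω → Matrix (Fin m) (Fin n) ℝ :=
  fun ω => jacH f h Xp U ω * jacF f Xp ω

/-- The matrix `A₁`. -/
noncomputable def matA₁ {Ω : Type*} [MeasurableSpace Ω] (μ : Measure Ω) {n m : ℕ}
    (f : EuclideanSpace ℝ (Fin n) → EuclideanSpace ℝ (Fin n))
    (h : EuclideanSpace ℝ (Fin n) → EuclideanSpace ℝ (Fin m))
    (Xp U : Ω → EuclideanSpace ℝ (Fin n)) (Pp : Matrix (Fin n) (Fin n) ℝ) :
    Matrix (Fin n ⊕ Fin m) (Fin n ⊕ Fin m) ℝ :=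
  Matrix.fromRows (expectation μ (jacF f Xp)) (expectation μ (jacHF f h Xp U)) * Pp *
    Matrix.fromCols (expectation μ (jacF f Xp)).transpose
      (expectation μ (jacHF f h Xp U)).transpose

/-- The matrix `B₁`. -/
noncomputable def matB₁ {Ω : Type*} [MeasurableSpace Ω] (μ : Measure Ω) {n m : ℕ}
    (f : EuclideanSpace ℝ (Fin n) → EuclideanSpace ℝ (Fin n))
    (h : EuclideanSpace ℝ (Fin n) → EuclideanSpace ℝ (Fin m))
    (Xp U : Ω → EuclideanSpace ℝ (Fin n)) (SU : Matrix (Fin n) (Fin n) ℝ) :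
    Matrix (Fin n ⊕ Fin m) (Fin n ⊕ Fin m) ℝ :=
  Matrix.fromRows (1 : Matrix (Fin n) (Fin n) ℝ) (expectation μ (jacH f h Xp U)) * SU *
    Matrix.fromCols (1 : Matrix (Fin n) (Fin n) ℝ) (expectation μ (jacH f h Xp U)).transpose

/-- The random matrix whose expectation is `A₂`. -/
noncomputable def integrandA₂ {Ω : Type*} {n m : ℕ}
    (f : EuclideanSpace ℝ (Fin n) → EuclideanSpace ℝ (Fin n))
    (h : EuclideanSpace ℝ (Fin n) → EuclideanSpace ℝ (Fin m))
    (Xp U : Ω → EuclideanSpace ℝ (Fin n)) (Pp SU : Matrix (Fin n) (Fin n) ℝ) :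
    Ω → Matrix (Fin n ⊕ Fin m) (Fin n ⊕ Fin m) ℝ :=
  fun ω =>
    Matrix.fromRows (1 : Matrix (Fin n) (Fin n) ℝ) (jacH f h Xp U ω) *
      (jacF f Xp ω * Pp * (jacF f Xp ω).transpose + SU) *
      Matrix.fromCols (1 : Matrix (Fin n) (Fin n) ℝ) (jacH f h Xp U ω).transpose

/-- The matrix `A₂`. -/
noncomputable def matA₂ {Ω : Type*} [MeasurableSpace Ω] (μ : Measure Ω) {n m : ℕ}
    (f : EuclideanSpace ℝ (Fin n) → EuclideanSpace ℝ (Fin n))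
    (h : EuclideanSpace ℝ (Fin n) → EuclideanSpace ℝ (Fin m))
    (Xp U : Ω → EuclideanSpace ℝ (Fin n)) (Pp SU : Matrix (Fin n) (Fin n) ℝ) :
    Matrix (Fin n ⊕ Fin m) (Fin n ⊕ Fin m) ℝ :=
  expectation μ (integrandA₂ f h Xp U Pp SU)

/-- The matrix `C_V`. -/
def matCV {m : ℕ} (n : ℕ) (SV : Matrix (Fin m) (Fin m) ℝ) :
    Matrix (Fin n ⊕ Fin m) (Fin n ⊕ Fin m) ℝ :=
  Matrix.fromBlocks 0 0 0 SV

/-!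
Testing the Löwner inequalities against a vector `a` turns them into bounds for the variance of one
scalar function `g` of the Gaussian pair `W = (Xp, U)`: the independent noise `V` contributes
exactly `aᵀ C_V a`, and the chain rule shows that `aᵀ A₂ a` is the mean of
`(∇₁g)ᵀ Pp ∇₁g + (∇₂g)ᵀ SU ∇₂g`, whereas `aᵀ (A₁ + B₁) a` is the same form evaluated at the mean
gradient. What remains are the two Gaussian variance bounds `(E ∇g)ᵀ Σ E ∇g ≤ Var g` and
`Var g ≤ E [(∇g)ᵀ Σ ∇g]`.

The upper bound is the Gaussian Poincaré inequality. It is proved for `E (g(W) - g(W'))²`, with `W'`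
an independent copy of `W`; this quantity makes sense in `[0, ∞]` for every measurable `g`, and its
finiteness gives `g(W) ∈ L²` (`memLp_two_of_doubledVariance_ne_top`). On the line,
`poincareInequality_gaussianReal` follows from Cauchy–Schwarz on each increment and the identity
`∫∫_{x ≤ t < y} (y - x) dγ dγ = φ(t)`. Products are handled by `doubledVariance_prod_le`, a pointwise
inequality for the four corners of a rectangle, so no regularity beyond differentiability and no
approximation is needed. General covariances come from the linear image under their square root.

The lower bound is Bessel's inequality for the coordinates of a standard Gaussian vector
(`gradientLowerBound_of_isSteinPair`): by Stein's identity the coefficients of `g` along them are its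
mean partial derivatives. Stein's identity is integration by parts on the line, and it extends to
products by Fubini.

Positive definiteness of `Pp` and `SU` enters in `integrable_of_integrable_quadraticForm`, by which
integrability of the entries of `A₂` implies that of the Jacobians in `A₁` and `B₁`.
-/

open scoped ENNReal

/-! ### Doubled variance -/

section Abstract

variable {E F : Type*} [MeasurableSpace E] [MeasurableSpace F]

/-- The mean of `(g x - g y) ^ 2` over independent `x, y` of law `μ`, in `[0, ∞]`. It is twice the
variance of `g` when `g` is square integrable. For measurable `g` and a probability measure it is
finite only in that case, so that bounding it also proves square integrability. -/
noncomputable def doubledVariance (μ : Measure E) (g : E → ℝ) : ℝ≥0∞ :=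
  ∫⁻ x, ∫⁻ y, ENNReal.ofReal ((g x - g y) ^ 2) ∂μ ∂μ

theorem doubledVariance_map {μ : Measure E} [SFinite μ] {T : E → F} (hT : Measurable T) {g : F → ℝ}
    (hg : Measurable g) : doubledVariance (μ.map T) g = doubledVariance μ (g ∘ T) := by
  unfold doubledVariance
  rw [lintegral_map (by fun_prop) hT]
  refine lintegral_congr fun x => ?_
  rw [lintegral_map (by fun_prop) hT]
  rfl

/-- Tensorization (Efron–Stein) without any integrability hypothesis. For the values `a`, `b`, `c`,
`d` of `g` at the corners `(x, s)`, `(x', s)`, `(x, s')`, `(x', s')` of a random rectangle, the two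
diagonals satisfy `(a - d)² + (b - c)² ≤ (a - b)² + (c - d)² + (a - c)² + (b - d)²`, the difference
being `(a - b - c + d)²`. -/
theorem doubledVariance_prod_le (μ : Measure E) (ν : Measure F) [IsProbabilityMeasure μ]
    [IsProbabilityMeasure ν] {g : E × F → ℝ} (hg : Measurable g) :
    doubledVariance (μ.prod ν) g ≤
      ∫⁻ s, doubledVariance μ (fun x => g (x, s)) ∂ν +
        ∫⁻ x, doubledVariance ν (fun s => g (x, s)) ∂μ := by
  have flat : ∀ k : (E × E) × (F × F) → ℝ, Measurable k →
      ∫⁻ q, ENNReal.ofReal (k q) ∂((μ.prod μ).prod (ν.prod ν)) =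
        ∫⁻ x, ∫⁻ x', ∫⁻ s, ∫⁻ s', ENNReal.ofReal (k ((x, x'), (s, s'))) ∂ν ∂ν ∂μ ∂μ := by
    intro k hk
    rw [lintegral_prod _ (by fun_prop), lintegral_prod _ (by fun_prop)]
    refine lintegral_congr fun x => lintegral_congr fun x' => ?_
    rw [lintegral_prod _ (by fun_prop)]
  have hD : doubledVariance (μ.prod ν) g =
      ∫⁻ x, ∫⁻ x', ∫⁻ s, ∫⁻ s', ENNReal.ofReal ((g (x, s) - g (x', s')) ^ 2) ∂ν ∂ν ∂μ ∂μ := by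
    unfold doubledVariance
    rw [lintegral_prod _ (by fun_prop)]
    refine lintegral_congr fun x => ?_
    trans ∫⁻ s, ∫⁻ x', ∫⁻ s', ENNReal.ofReal ((g (x, s) - g (x', s')) ^ 2) ∂ν ∂μ ∂ν
    · refine lintegral_congr fun s => ?_
      rw [lintegral_prod _ (by fun_prop)]
    · rw [lintegral_lintegral_swap (by fun_prop)]
  -- `h1`, `h2` are the two diagonals of the rectangle, `h3`–`h6` its four sides
  have h1 : ∫⁻ q, ENNReal.ofReal ((g (q.1.1, q.2.1) - g (q.1.2, q.2.2)) ^ 2)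
      ∂((μ.prod μ).prod (ν.prod ν)) = doubledVariance (μ.prod ν) g := by
    rw [flat _ (by fun_prop), hD]
  have h2 : ∫⁻ q, ENNReal.ofReal ((g (q.1.2, q.2.1) - g (q.1.1, q.2.2)) ^ 2)
      ∂((μ.prod μ).prod (ν.prod ν)) = doubledVariance (μ.prod ν) g := by
    rw [flat _ (by fun_prop), hD, lintegral_lintegral_swap (by fun_prop)]
  have hA : ∫⁻ s, doubledVariance μ (fun x => g (x, s)) ∂ν =
      ∫⁻ x, ∫⁻ x', ∫⁻ s, ENNReal.ofReal ((g (x, s) - g (x', s)) ^ 2) ∂ν ∂μ ∂μ := by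
    unfold doubledVariance
    rw [lintegral_lintegral_swap (by fun_prop)]
    refine lintegral_congr fun x => ?_
    rw [lintegral_lintegral_swap (by fun_prop)]
  have h3 : ∫⁻ q, ENNReal.ofReal ((g (q.1.1, q.2.1) - g (q.1.2, q.2.1)) ^ 2)
      ∂((μ.prod μ).prod (ν.prod ν)) = ∫⁻ s, doubledVariance μ (fun x => g (x, s)) ∂ν := by
    rw [flat _ (by fun_prop), hA]
    simp
  have h4 : ∫⁻ q, ENNReal.ofReal ((g (q.1.1, q.2.2) - g (q.1.2, q.2.2)) ^ 2)
      ∂((μ.prod μ).prod (ν.prod ν)) = ∫⁻ s, doubledVariance μ (fun x => g (x, s)) ∂ν := by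
    rw [flat _ (by fun_prop), hA]
    simp
  have h5 : ∫⁻ q, ENNReal.ofReal ((g (q.1.1, q.2.1) - g (q.1.1, q.2.2)) ^ 2)
      ∂((μ.prod μ).prod (ν.prod ν)) = ∫⁻ x, doubledVariance ν (fun s => g (x, s)) ∂μ := by
    rw [flat _ (by fun_prop)]
    simp [doubledVariance]
  have h6 : ∫⁻ q, ENNReal.ofReal ((g (q.1.2, q.2.1) - g (q.1.2, q.2.2)) ^ 2)
      ∂((μ.prod μ).prod (ν.prod ν)) = ∫⁻ x, doubledVariance ν (fun s => g (x, s)) ∂μ := by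
    rw [flat _ (by fun_prop)]
    simp [doubledVariance]
  have key : 2 * doubledVariance (μ.prod ν) g ≤
      2 * (∫⁻ s, doubledVariance μ (fun x => g (x, s)) ∂ν +
        ∫⁻ x, doubledVariance ν (fun s => g (x, s)) ∂μ) := by
    rw [mul_add, two_mul, two_mul, two_mul]
    nth_rewrite 1 [← h1]
    nth_rewrite 1 [← h2]
    nth_rewrite 1 [← h3]
    nth_rewrite 1 [← h4]
    nth_rewrite 1 [← h5]
    nth_rewrite 1 [← h6]
    rw [← lintegral_add_left (by fun_prop), ← lintegral_add_left (by fun_prop),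
      ← lintegral_add_left (by fun_prop), ← lintegral_add_left (by fun_prop)]
    refine lintegral_mono fun q => ?_
    simp only
    rw [← ENNReal.ofReal_add (by positivity) (by positivity),
      ← ENNReal.ofReal_add (by positivity) (by positivity),
      ← ENNReal.ofReal_add (by positivity) (by positivity),
      ← ENNReal.ofReal_add (by positivity) (by positivity)]
    refine ENNReal.ofReal_le_ofReal ?_
    nlinarith [sq_nonneg (g (q.1.1, q.2.1) - g (q.1.2, q.2.1) - g (q.1.1, q.2.2) +
      g (q.1.2, q.2.2))]
  exact (ENNReal.mul_le_mul_iff_right (by simp) (by simp)).1 key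

theorem memLp_two_of_doubledVariance_ne_top {μ : Measure E} [IsProbabilityMeasure μ] {g : E → ℝ}
    (hg : Measurable g) (h : doubledVariance μ g ≠ ∞) : MemLp g 2 μ := by
  have hae := ae_lt_top (f := fun x => ∫⁻ y, ENNReal.ofReal ((g x - g y) ^ 2) ∂μ)
    (by fun_prop) h
  obtain ⟨x, hx⟩ := hae.exists
  have h1 : MemLp (fun y => g x - g y) 2 μ := by
    rw [memLp_two_iff_integrable_sq (by fun_prop)]
    refine ⟨by fun_prop, ?_⟩
    rwa [hasFiniteIntegral_iff_ofReal (ae_of_all _ fun y => by positivity)]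
  have := (memLp_const (g x)).sub h1
  refine this.congr_norm hg.aestronglyMeasurable (ae_of_all _ fun y => ?_)
  simp

theorem doubledVariance_eq_ofReal_variance {μ : Measure E} [IsProbabilityMeasure μ] {g : E → ℝ}
    (hg : MemLp g 2 μ) : doubledVariance μ g = 2 * ENNReal.ofReal Var[g; μ] := by
  have hi : Integrable g μ := hg.integrable (by norm_num)
  have h2 : Integrable (fun x => g x ^ 2) μ := hg.integrable_sq
  have inner : ∀ x, ∫⁻ y, ENNReal.ofReal ((g x - g y) ^ 2) ∂μ =
      ENNReal.ofReal (g x ^ 2 - 2 * g x * ∫ y, g y ∂μ + ∫ y, g y ^ 2 ∂μ) := by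
    intro x
    have he : (fun y => (g x - g y) ^ 2) = fun y => g x ^ 2 - 2 * g x * g y + g y ^ 2 := by
      ext y; ring
    have hin : Integrable (fun y => g x ^ 2 - 2 * g x * g y) μ :=
      (integrable_const _).sub (hi.const_mul _)
    rw [← ofReal_integral_eq_lintegral_ofReal (he ▸ hin.add h2)
      (ae_of_all _ fun y => by positivity), he, integral_add hin h2,
      integral_sub (integrable_const _) (hi.const_mul _), integral_const_mul]
    simp
  have hin : Integrable (fun x => g x ^ 2 - 2 * g x * ∫ y, g y ∂μ) μ :=
      h2.sub ((hi.const_mul _).mul_const _)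
  have hnn : ∀ x, 0 ≤ g x ^ 2 - 2 * g x * ∫ y, g y ∂μ + ∫ y, g y ^ 2 ∂μ := by
    intro x
    have := variance_nonneg g μ
    rw [variance_eq_sub hg] at this
    simp only [Pi.pow_apply] at this
    nlinarith [sq_nonneg (g x - ∫ y, g y ∂μ)]
  unfold doubledVariance
  simp_rw [inner]
  have hin' : Integrable
      (fun x => g x ^ 2 - 2 * g x * ∫ y, g y ∂μ + ∫ y, g y ^ 2 ∂μ) μ :=
    hin.add (integrable_const _)
  rw [← ofReal_integral_eq_lintegral_ofReal hin' (ae_of_all _ hnn), integral_add hin (integrable_const _),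
    integral_sub h2 ((hi.const_mul _).mul_const _), integral_mul_const, integral_const_mul,
    variance_eq_sub hg, ← ENNReal.ofReal_ofNat 2, ← ENNReal.ofReal_mul zero_le_two]
  congr 1
  simp
  ring

end Abstract

/-! ### Directional derivatives of slices and affine compositions -/

section Slices

variable {E F : Type*} [NormedAddCommGroup E] [NormedSpace ℝ E]
  [NormedAddCommGroup F] [NormedSpace ℝ F]

theorem fderiv_comp_affine {g : F → ℝ} (hg : Differentiable ℝ g) (a : F) (L : E →L[ℝ] F)
    (x v : E) : fderiv ℝ (fun x => g (a + L x)) x v = fderiv ℝ g (a + L x) (L v) := by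
  have h1 : HasFDerivAt (fun x => a + L x) L x := L.hasFDerivAt.const_add a
  exact congrArg (fun D => D v) ((hg _).hasFDerivAt.comp x h1).fderiv

theorem fderiv_slice_left {g : E × F → ℝ} (hg : Differentiable ℝ g) (x : E) (s : F) (v : E) :
    fderiv ℝ (fun x => g (x, s)) x v = fderiv ℝ g (x, s) (v, 0) := by
  exact congrArg (fun D => D v)
    ((hg (x, s)).hasFDerivAt.comp x (hasFDerivAt_prodMk_left (𝕜 := ℝ) x s)).fderiv

theorem fderiv_slice_right {g : E × F → ℝ} (hg : Differentiable ℝ g) (x : E) (s : F) (v : F) :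
    fderiv ℝ (fun s => g (x, s)) s v = fderiv ℝ g (x, s) (0, v) := by
  exact congrArg (fun D => D v)
    ((hg (x, s)).hasFDerivAt.comp s (hasFDerivAt_prodMk_right (𝕜 := ℝ) x s)).fderiv

end Slices

/-! ### Poincaré inequalities and lower variance bounds -/

section Inequalities

variable {E F : Type*} [NormedAddCommGroup E] [NormedSpace ℝ E] [MeasurableSpace E] [BorelSpace E]
  [NormedAddCommGroup F] [NormedSpace ℝ F] [MeasurableSpace F] [BorelSpace F]
  {ι κ : Type*}

/-- `μ` satisfies the Poincaré inequality with energy `∑ i, (∂_{v i} g) ^ 2`. The factor `2` offsets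
the one in `doubledVariance`. The inequality is asked of every differentiable `g`, square integrable
or not. -/
def PoincareInequality [Fintype ι] (μ : Measure E) (v : ι → E) : Prop :=
  ∀ g : E → ℝ, Differentiable ℝ g →
    doubledVariance μ g ≤ 2 * ∑ i, ∫⁻ x, ENNReal.ofReal (fderiv ℝ g x (v i) ^ 2) ∂μ

/-- Stein's identity (Gaussian integration by parts): under `μ`, multiplication by the score `ξ` is
dual to differentiation in the direction `v`. Only the integrability of the two integrands is
required, a condition which passes to almost every slice of a product. -/
def IsSteinPair (μ : Measure E) (v : E) (ξ : E → ℝ) : Prop :=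
  ∀ g : E → ℝ, Differentiable ℝ g → Integrable (fun x => ξ x * g x) μ →
    Integrable (fun x => fderiv ℝ g x v) μ → ∫ x, ξ x * g x ∂μ = ∫ x, fderiv ℝ g x v ∂μ

/-- The reverse of the Poincaré inequality, for the mean gradient:
`∑ i, (E ∂_{v i} g) ^ 2 ≤ Var g`. -/
def GradientLowerBound [Fintype ι] (μ : Measure E) (v : ι → E) : Prop :=
  ∀ g : E → ℝ, Differentiable ℝ g → MemLp g 2 μ →
    (∀ i, Integrable (fun x => fderiv ℝ g x (v i)) μ) →
    ∑ i, (∫ x, fderiv ℝ g x (v i) ∂μ) ^ 2 ≤ Var[g; μ]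

theorem PoincareInequality.map_affine [Fintype ι] {μ : Measure E} [SFinite μ] {v : ι → E}
    (h : PoincareInequality μ v) (a : F) (L : E →L[ℝ] F) :
    PoincareInequality (μ.map fun x => a + L x) (fun i => L (v i)) := by
  intro g hg
  have hT : Measurable fun x => a + L x := (by fun_prop : Continuous fun x => a + L x).measurable
  rw [doubledVariance_map hT hg.continuous.measurable]
  refine (h _ (by fun_prop)).trans_eq ?_
  congr 1
  refine Finset.sum_congr rfl fun i _ => ?_
  rw [lintegral_map (by have := measurable_fderiv_apply_const ℝ g (L (v i)); fun_prop) hT]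
  refine lintegral_congr fun x => ?_
  rw [← fderiv_comp_affine hg]
  rfl

theorem GradientLowerBound.map_affine [Fintype ι] {μ : Measure E} {v : ι → E}
    (h : GradientLowerBound μ v) (a : F) (L : E →L[ℝ] F) :
    GradientLowerBound (μ.map fun x => a + L x) (fun i => L (v i)) := by
  intro g hg hg2 hi
  have hT : Measurable fun x => a + L x := (by fun_prop : Continuous fun x => a + L x).measurable
  have hgm := hg.continuous.measurable
  rw [variance_map hgm.aemeasurable hT.aemeasurable]
  have key : ∀ i, (fun x => fderiv ℝ g (a + L x) (L (v i))) =
      fun x => fderiv ℝ (fun x => g (a + L x)) x (v i) := by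
    intro i; ext x; rw [fderiv_comp_affine hg]
  have hm : ∀ i, Measurable fun x => fderiv ℝ g x (L (v i)) :=
    fun i => measurable_fderiv_apply_const ℝ g _
  refine le_trans (le_of_eq ?_) (h (fun x => g (a + L x)) (by fun_prop)
    (hg2.comp_measurePreserving ⟨hT, rfl⟩) fun i => ?_)
  · refine Finset.sum_congr rfl fun i _ => ?_
    rw [integral_map hT.aemeasurable (hm i).aestronglyMeasurable, key i]
  · rw [← key i]
    exact (integrable_map_measure (hm i).aestronglyMeasurable hT.aemeasurable).1 (hi i)

theorem IsSteinPair.map_linear {μ : Measure E} {v : E} {ξ : F → ℝ} {L : E →L[ℝ] F}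
    (h : IsSteinPair μ v fun x => ξ (L x)) (hξ : Measurable ξ) :
    IsSteinPair (μ.map L) (L v) ξ := by
  intro g hg h1 h2
  have hT : Measurable L := L.continuous.measurable
  have hgm := hg.continuous.measurable
  have key : (fun x => fderiv ℝ g (L x) (L v)) = fun x => fderiv ℝ (fun x => g (L x)) x v := by
    ext x
    simpa using (fderiv_comp_affine hg 0 L x v).symm
  have hm : Measurable fun x => fderiv ℝ g x (L v) := measurable_fderiv_apply_const ℝ g _
  have hm' : Measurable fun x => ξ x * g x := hξ.mul hgm
  rw [integral_map hT.aemeasurable hm'.aestronglyMeasurable,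
    integral_map hT.aemeasurable hm.aestronglyMeasurable, key]
  refine h (fun x => g (L x)) (by fun_prop) ?_ ?_
  · exact (integrable_map_measure hm'.aestronglyMeasurable hT.aemeasurable).1 h1
  · rw [← key]
    exact (integrable_map_measure hm.aestronglyMeasurable hT.aemeasurable).1 h2

theorem PoincareInequality.prod [SecondCountableTopology E]
    [SecondCountableTopology F] [Fintype ι] [Fintype κ] {μ : Measure E} {ν : Measure F}
    [IsProbabilityMeasure μ] [IsProbabilityMeasure ν] {v : ι → E} {w : κ → F}
    (hμ : PoincareInequality μ v) (hν : PoincareInequality ν w) :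
    PoincareInequality (μ.prod ν)
      (Sum.elim (fun i => ((v i, 0) : E × F)) fun j => ((0, w j) : E × F)) := by
  intro g hg
  have hm : ∀ v, Measurable fun x => fderiv ℝ g x v := fun v => measurable_fderiv_apply_const ℝ g v
  refine (doubledVariance_prod_le μ ν hg.continuous.measurable).trans ?_
  rw [Fintype.sum_sum_type, mul_add]
  simp only [Sum.elim_inl, Sum.elim_inr]
  refine add_le_add ?_ ?_
  · calc ∫⁻ s, doubledVariance μ (fun x => g (x, s)) ∂ν
        ≤ ∫⁻ s, 2 * ∑ i, ∫⁻ x, ENNReal.ofReal (fderiv ℝ g (x, s) (v i, 0) ^ 2) ∂μ ∂ν := by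
          refine lintegral_mono fun s => ?_
          simpa only [fderiv_slice_left hg] using hμ (fun x => g (x, s)) (by fun_prop)
      _ = _ := by
          rw [lintegral_const_mul _ (by fun_prop), lintegral_finsetSum _ (by fun_prop)]
          congr 1
          refine Finset.sum_congr rfl fun i _ => ?_
          rw [lintegral_prod_symm _ (by fun_prop)]
  · calc ∫⁻ x, doubledVariance ν (fun s => g (x, s)) ∂μ
        ≤ ∫⁻ x, 2 * ∑ i, ∫⁻ s, ENNReal.ofReal (fderiv ℝ g (x, s) (0, w i) ^ 2) ∂ν ∂μ := by
          refine lintegral_mono fun x => ?_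
          simpa only [fderiv_slice_right hg] using hν (fun s => g (x, s)) (by fun_prop)
      _ = _ := by
          rw [lintegral_const_mul _ (by fun_prop), lintegral_finsetSum _ (by fun_prop)]
          congr 1
          refine Finset.sum_congr rfl fun i _ => ?_
          rw [lintegral_prod _ (by fun_prop)]

end Inequalities

/-! ### Stein pairs and Bessel's inequality -/

section Stein

variable {E F : Type*} [NormedAddCommGroup E] [NormedSpace ℝ E] [MeasurableSpace E]
  [NormedAddCommGroup F] [NormedSpace ℝ F] [MeasurableSpace F] {ι : Type*}

theorem IsSteinPair.prod_left {μ : Measure E} {ν : Measure F} [SFinite μ] [SFinite ν]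
    {v : E} {ξ : E → ℝ} (h : IsSteinPair μ v ξ) :
    IsSteinPair (μ.prod ν) ((v, 0) : E × F) fun p => ξ p.1 := by
  intro g hg h1 h2
  rw [integral_prod_symm _ h1, integral_prod_symm _ h2]
  refine integral_congr_ae ?_
  filter_upwards [h1.prod_left_ae, h2.prod_left_ae] with s hs1 hs2
  simp only [← fderiv_slice_left hg] at hs2 ⊢
  exact h (fun x => g (x, s)) (by fun_prop) hs1 hs2

theorem IsSteinPair.prod_right {μ : Measure E} {ν : Measure F} [SFinite μ] [SFinite ν]
    {v : F} {ξ : F → ℝ} (h : IsSteinPair ν v ξ) :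
    IsSteinPair (μ.prod ν) ((0, v) : E × F) fun p => ξ p.2 := by
  intro g hg h1 h2
  rw [integral_prod _ h1, integral_prod _ h2]
  refine integral_congr_ae ?_
  filter_upwards [h1.prod_right_ae, h2.prod_right_ae] with s hs1 hs2
  simp only [← fderiv_slice_right hg] at hs2 ⊢
  exact h (fun x => g (s, x)) (by fun_prop) hs1 hs2

/-- If the linear scores `ξ i` are dual to the directions `v i`, Stein's identity applied to the
`ξ i` themselves shows that they are centred and orthonormal, and applied to `g` that `E ∂_{v i} g`
is the `i`-th coefficient of `g`. The lower bound is then Bessel's inequality. -/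
theorem gradientLowerBound_of_isSteinPair [Fintype ι] [DecidableEq ι] {μ : Measure E}
    [IsProbabilityMeasure μ]
    {v : ι → E} {ξ : ι → E →L[ℝ] ℝ} (hξ : ∀ i, MemLp (ξ i) 2 μ)
    (hdual : ∀ i j, ξ i (v j) = if i = j then 1 else 0)
    (h : ∀ i, IsSteinPair μ (v i) (ξ i)) : GradientLowerBound μ v := by
  intro g hg hg2 hi
  set c : ι → ℝ := fun i => ∫ x, fderiv ℝ g x (v i) ∂μ with hc
  set ℓ : E →L[ℝ] ℝ := ∑ i, c i • ξ i with hℓ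
  have hℓx : ∀ x, ℓ x = ∑ i, c i * ξ i x := by intro x; simp [hℓ]
  have hℓ2 : MemLp ℓ 2 μ := by
    have : (ℓ : E → ℝ) = fun x => ∑ i, c i * ξ i x := funext hℓx
    rw [this]
    exact memLp_finsetSum _ fun i _ => (hξ i).const_mul _
  have hmul : ∀ {p q : E → ℝ}, MemLp p 2 μ → MemLp q 2 μ → Integrable (fun x => p x * q x) μ :=
    fun hp hq => hp.integrable_mul hq
  have hξ0 : ∀ i, ∫ x, ξ i x ∂μ = 0 := by
    intro i
    have := h i (fun _ => 1) (by fun_prop)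
      (by simpa using (hξ i).integrable (by norm_num)) (by simp)
    simpa using this
  have hℓ0 : ∫ x, ℓ x ∂μ = 0 := by
    simp_rw [hℓx]
    rw [integral_finsetSum _ fun i _ => ((hξ i).integrable (by norm_num)).const_mul _]
    simp [integral_const_mul, hξ0]
  -- pairing `ℓ` with a function computes its mean derivatives
  have pair : ∀ k : E → ℝ, Differentiable ℝ k → MemLp k 2 μ →
      (∀ i, Integrable (fun x => fderiv ℝ k x (v i)) μ) →
      ∫ x, ℓ x * k x ∂μ = ∑ i, c i * ∫ x, fderiv ℝ k x (v i) ∂μ := by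
    intro k hk hk2 hki
    simp_rw [hℓx, Finset.sum_mul, mul_assoc]
    rw [integral_finsetSum _ fun i _ => (hmul (hξ i) hk2).const_mul _]
    refine Finset.sum_congr rfl fun i _ => ?_
    rw [integral_const_mul, h i k hk (hmul (hξ i) hk2) (hki i)]
  have hg' : ∫ x, ℓ x * g x ∂μ = ∑ i, c i ^ 2 := by
    rw [pair g hg hg2 hi]
    exact Finset.sum_congr rfl fun i _ => by rw [sq]
  have hℓℓ : ∫ x, ℓ x * ℓ x ∂μ = ∑ i, c i ^ 2 := by
    rw [pair ℓ ℓ.differentiable hℓ2 fun i => by simp]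
    refine Finset.sum_congr rfl fun i _ => ?_
    simp [hℓx, hdual, sq]
  have hvar : Var[g; μ] - ∑ i, c i ^ 2 = Var[g - ⇑ℓ; μ] := by
    have hgi : Integrable g μ := hg2.integrable (by norm_num)
    have hli : Integrable ℓ μ := hℓ2.integrable (by norm_num)
    rw [variance_eq_sub hg2, variance_eq_sub (hg2.sub hℓ2)]
    have e1 : ∫ x, ((g - ⇑ℓ) ^ 2) x ∂μ = ∫ x, (g ^ 2) x ∂μ - ∑ i, c i ^ 2 := by
      have : ((g - ⇑ℓ) ^ 2) = fun x => g x ^ 2 - 2 * (ℓ x * g x) + ℓ x * ℓ x := by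
        ext x; simp; ring
      have hin : Integrable (fun x => g x ^ 2 - 2 * (ℓ x * g x)) μ :=
        hg2.integrable_sq.sub ((hmul hℓ2 hg2).const_mul _)
      rw [this, integral_add hin (hmul hℓ2 hℓ2), integral_sub hg2.integrable_sq
        ((hmul hℓ2 hg2).const_mul _), integral_const_mul, hg', hℓℓ]
      simp only [Pi.pow_apply]
      ring
    have e2 : ∫ x, (g - ⇑ℓ) x ∂μ = ∫ x, g x ∂μ := by
      simp only [Pi.sub_apply]
      rw [integral_sub hgi hli, hℓ0, sub_zero]
    rw [e1, e2]
    ring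
  have := variance_nonneg (g - ⇑ℓ) μ
  linarith

end Stein

/-! ### The standard Gaussian on the line -/

section OneDim

theorem hasDerivAt_gaussianPDFReal (x : ℝ) :
    HasDerivAt (gaussianPDFReal 0 1) (-x * gaussianPDFReal 0 1 x) x := by
  have h1 : HasDerivAt (fun x : ℝ => -(x - 0) ^ 2 / (2 * ((1 : NNReal) : ℝ))) (-x) x := by
    refine ((((hasDerivAt_id x).sub_const 0).pow 2).neg.div_const
      (2 * ((1 : NNReal) : ℝ))).congr_deriv ?_
    norm_num
    ring
  rw [gaussianPDFReal_def]
  refine (h1.exp.const_mul ((√(2 * Real.pi * ((1 : NNReal) : ℝ)))⁻¹)).congr_deriv ?_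
  ring

theorem integral_gaussianReal_zero_one (k : ℝ → ℝ) :
    ∫ x, k x ∂(gaussianReal 0 1) = ∫ x, gaussianPDFReal 0 1 x * k x := by
  simpa using integral_gaussianReal_eq_integral_smul (μ := 0) (v := 1) one_ne_zero (f := k)

theorem integrable_gaussianReal_zero_one_iff (k : ℝ → ℝ) :
    Integrable k (gaussianReal 0 1) ↔ Integrable fun x => gaussianPDFReal 0 1 x * k x := by
  rw [gaussianReal_of_var_ne_zero 0 one_ne_zero,
    integrable_withDensity_iff_integrable_smul' (measurable_gaussianPDF 0 1)
      (ae_of_all _ fun _ => gaussianPDF_lt_top)]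
  simp [smul_eq_mul]

theorem lintegral_gaussianReal_zero_one {k : ℝ → ℝ≥0∞} (hk : Measurable k) :
    ∫⁻ x, k x ∂(gaussianReal 0 1) = ∫⁻ x, gaussianPDF 0 1 x * k x := by
  rw [gaussianReal_of_var_ne_zero 0 one_ne_zero,
    lintegral_withDensity_eq_lintegral_mul _ (by fun_prop) hk]
  rfl

theorem isSteinPair_gaussianReal : IsSteinPair (gaussianReal 0 1) 1 fun x => x := by
  intro g hg h1 h2
  simp only [fderiv_apply_one_eq_deriv] at h2 ⊢
  have hφ : Continuous (gaussianPDFReal 0 1) :=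
    (show Differentiable ℝ (gaussianPDFReal 0 1) from
      fun x => (hasDerivAt_gaussianPDFReal x).differentiableAt).continuous
  have h0 : Integrable g (gaussianReal 0 1) := by
    -- `|g| ≤ |x g|` away from `[-1, 1]`, where `g` is bounded
    obtain ⟨C, hC⟩ := isCompact_Icc.exists_bound_of_continuousOn
      (hg.continuous.continuousOn (s := Set.Icc (-1 : ℝ) 1))
    refine (h1.norm.add (integrable_const C)).mono' hg.continuous.aestronglyMeasurable
      (ae_of_all _ fun x => ?_)
    simp only [Pi.add_apply, norm_mul]
    by_cases hx : x ∈ Set.Icc (-1 : ℝ) 1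
    · have : 0 ≤ ‖x‖ * ‖g x‖ := by positivity
      linarith [hC x hx]
    · have hx1 : 1 ≤ ‖x‖ := by
        rw [Real.norm_eq_abs]
        by_contra! hlt
        exact hx ⟨(abs_lt.1 hlt).1.le, (abs_lt.1 hlt).2.le⟩
      have hC0 : 0 ≤ C := (norm_nonneg _).trans (hC 0 (by simp))
      nlinarith [norm_nonneg (g x)]
  rw [integrable_gaussianReal_zero_one_iff] at h0 h1 h2
  rw [integral_gaussianReal_zero_one, integral_gaussianReal_zero_one]
  have := integral_mul_deriv_eq_deriv_mul_of_integrable (u := g) (v := gaussianPDFReal 0 1)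
    (u' := deriv g) (v' := fun x => -x * gaussianPDFReal 0 1 x)
    (fun x _ => (hg x).hasDerivAt) (fun x _ => hasDerivAt_gaussianPDFReal x)
    (by convert h1.neg using 1; ext x; simp; ring) (by convert h2 using 1; ext x; simp; ring)
    (by convert h0 using 1; ext x; simp; ring)
  have e1 : ∫ x, gaussianPDFReal 0 1 x * (x * g x) = -∫ x, g x * (-x * gaussianPDFReal 0 1 x) := by
    rw [← integral_neg]
    congr 1; ext x; ring
  rw [e1, this, neg_neg]
  congr 1; ext x; ring

/-- The Gaussian density is a primitive of `-x φ(x)`. -/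
theorem setIntegral_Ioi_gaussianReal (t : ℝ) :
    ∫ x in Set.Ioi t, x ∂(gaussianReal 0 1) = gaussianPDFReal 0 1 t := by
  have hi : Integrable (fun x => gaussianPDFReal 0 1 x * x) := by
    rw [← integrable_gaussianReal_zero_one_iff]
    exact IsGaussian.integrable_id
  have hi' : Integrable (fun x => -x * gaussianPDFReal 0 1 x) := by
    convert hi.neg using 1; ext x; simp; ring
  have hlim := tendsto_zero_of_hasDerivAt_of_integrableOn_Ioi (a := t)
    (fun x _ => hasDerivAt_gaussianPDFReal x) hi'.integrableOn
    (integrable_gaussianPDFReal 0 1).integrableOn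
  have h := integral_Ioi_of_hasDerivAt_of_tendsto' (a := t)
    (fun x _ => hasDerivAt_gaussianPDFReal x) hi'.integrableOn hlim
  rw [← integral_indicator measurableSet_Ioi, integral_gaussianReal_zero_one]
  simp_rw [← Set.indicator_mul_right]
  rw [integral_indicator measurableSet_Ioi, ← neg_inj, ← integral_neg]
  simp only [zero_sub] at h
  rw [← h]
  congr 1; ext x; ring

/-- The Poincaré kernel. With `p` and `q` the masses of the half-lines below and above `t`, the two
partial moments are `φ(t) - t q` and `φ(t) + t p`, and `p + q = 1`. -/
theorem gaussianReal_kernel (t : ℝ) :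
    gaussianReal 0 1 (Set.Iic t) * ∫⁻ y, ENNReal.ofReal (y - t) ∂(gaussianReal 0 1) +
      gaussianReal 0 1 (Set.Ioi t) * ∫⁻ x, ENNReal.ofReal (t - x) ∂(gaussianReal 0 1) =
      gaussianPDF 0 1 t := by
  set γ := gaussianReal 0 1
  have hid : Integrable (fun x : ℝ => x) γ := IsGaussian.integrable_id
  have h0 : ∫ x, x ∂γ = 0 := by simp [γ]
  have hp : Integrable (fun y => max (y - t) 0) γ := (hid.sub (integrable_const t)).pos_part
  have hm : Integrable (fun x => max (t - x) 0) γ := ((integrable_const t).sub hid).pos_part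
  have hab : γ.real (Set.Iic t) = 1 - γ.real (Set.Ioi t) := by
    rw [← Set.compl_Ioi, probReal_compl_eq_one_sub measurableSet_Ioi]
  have ep : ∫ y, max (y - t) 0 ∂γ = gaussianPDFReal 0 1 t - t * γ.real (Set.Ioi t) := by
    have : (fun y => max (y - t) 0) = Set.indicator (Set.Ioi t) fun y => y - t := by
      ext y
      by_cases h : t < y
      · simp [Set.indicator, h, h.le]
      · simp [Set.indicator, h, not_lt.1 h]
    rw [this, integral_indicator measurableSet_Ioi, integral_sub hid.integrableOn
      (integrable_const _), setIntegral_Ioi_gaussianReal]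
    simp [mul_comm]
  have em : ∫ x, max (t - x) 0 ∂γ = gaussianPDFReal 0 1 t + t * γ.real (Set.Iic t) := by
    have : (fun x => max (t - x) 0) = fun x => max (x - t) 0 + (t - x) := by
      ext x
      rcases le_total t x with h | h
      · rw [max_eq_right (by linarith), max_eq_left (by linarith)]; ring
      · rw [max_eq_left (by linarith), max_eq_right (by linarith)]; ring
    have hti : Integrable (fun x => t - x) γ := (integrable_const t).sub hid
    rw [this, integral_add hp hti, integral_sub (integrable_const t) hid,
      ep, h0, hab]
    simp
    ring
  have conv : ∀ {k : ℝ → ℝ}, Integrable (fun x => max (k x) 0) γ →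
      ∫⁻ x, ENNReal.ofReal (k x) ∂γ = ENNReal.ofReal (∫ x, max (k x) 0 ∂γ) := by
    intro k hk
    rw [ofReal_integral_eq_lintegral_ofReal hk (ae_of_all _ fun x => le_max_right _ _)]
    refine lintegral_congr fun x => ?_
    rw [ENNReal.ofReal_max]
    simp
  rw [conv hp, conv hm, ← ofReal_measureReal, ← ofReal_measureReal,
    ← ENNReal.ofReal_mul measureReal_nonneg, ← ENNReal.ofReal_mul measureReal_nonneg,
    ← ENNReal.ofReal_add
      (mul_nonneg measureReal_nonneg (integral_nonneg fun y => le_max_right (y - t) 0))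
      (mul_nonneg measureReal_nonneg (integral_nonneg fun x => le_max_right (t - x) 0)), ep, em, hab, gaussianPDF_def]
  congr 1
  ring

/-- Cauchy–Schwarz for the increment of `g`. Continuity of the derivative is not needed: if the right
side is finite then `deriv g` is integrable on the interval, and the fundamental theorem of calculus
holds for functions that are differentiable everywhere with integrable derivative. -/
theorem ofReal_sub_sq_le {g : ℝ → ℝ} (hg : Differentiable ℝ g) {x y : ℝ} (hxy : x ≤ y) :
    ENNReal.ofReal ((g x - g y) ^ 2) ≤
      ENNReal.ofReal (y - x) * ∫⁻ t in Set.Ioc x y, ENNReal.ofReal (deriv g t ^ 2) := by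
  have hm : Measurable (deriv g) := measurable_deriv g
  by_cases hfin : ∫⁻ t in Set.Ioc x y, ENNReal.ofReal (deriv g t ^ 2) = ∞
  · rcases hxy.eq_or_lt with rfl | hlt
    · simp
    · rw [hfin, ENNReal.mul_top (by simpa using hlt)]
      exact le_top
  have hL2 : MemLp (deriv g) 2 (volume.restrict (Set.Ioc x y)) := by
    rw [memLp_two_iff_integrable_sq hm.aestronglyMeasurable]
    refine ⟨by fun_prop, ?_⟩
    rw [hasFiniteIntegral_iff_ofReal (ae_of_all _ fun y => by positivity)]
    exact lt_top_iff_ne_top.2 hfin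
  have hL1 : Integrable (deriv g) (volume.restrict (Set.Ioc x y)) := hL2.integrable (by norm_num)
  have hftc : ∫ t in x..y, deriv g t = g y - g x :=
    intervalIntegral.integral_eq_sub_of_hasDerivAt (fun t _ => (hg t).hasDerivAt)
      ((intervalIntegrable_iff_integrableOn_Ioc_of_le hxy).2 hL1)
  rw [intervalIntegral.integral_of_le hxy] at hftc
  rw [← ofReal_integral_eq_lintegral_ofReal hL2.integrable_sq (ae_of_all _ fun y => by positivity),
    ← ENNReal.ofReal_mul (by linarith)]
  refine ENNReal.ofReal_le_ofReal ?_
  set I := ∫ t in Set.Ioc x y, deriv g t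
  set Q := ∫ t in Set.Ioc x y, deriv g t ^ 2
  have hvol : volume.real (Set.Ioc x y) = y - x := by simp [hxy]
  -- the quadratic `∫ (g' - c)² ≥ 0`, to be evaluated at `c = I / (y - x)`
  have hquad : ∀ c : ℝ, 0 ≤ Q - 2 * c * I + c ^ 2 * (y - x) := by
    intro c
    have : ∫ t in Set.Ioc x y, (deriv g t - c) ^ 2 = Q - 2 * c * I + c ^ 2 * (y - x) := by
      have he : (fun t => (deriv g t - c) ^ 2) =
          fun t => deriv g t ^ 2 - 2 * c * deriv g t + c ^ 2 := by ext t; ring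
      have hin : IntegrableOn (fun t => deriv g t ^ 2 - 2 * c * deriv g t) (Set.Ioc x y) :=
        hL2.integrable_sq.sub (hL1.const_mul _)
      rw [he, integral_add hin (integrable_const _),
        integral_sub hL2.integrable_sq (hL1.const_mul _), integral_const_mul]
      simp only [integral_const, smul_eq_mul, measureReal_restrict_apply_univ, hvol]
      ring
    rw [← this]
    positivity
  have hI : g x - g y = -I := by rw [hftc]; ring
  rw [hI, neg_sq]
  rcases hxy.eq_or_lt with rfl | hlt
  · simp [I]
  · have hpos : 0 < y - x := by linarith
    have := hquad (I / (y - x))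
    have e : Q - 2 * (I / (y - x)) * I + (I / (y - x)) ^ 2 * (y - x) = Q - I ^ 2 / (y - x) := by
      field_simp; ring
    rw [e, sub_nonneg, div_le_iff₀ hpos] at this
    linarith

/-- `∫∫_{x ≤ t < y} (y - x) dγ(x) dγ(y) = φ(t)`: the weight with which the derivative at `t`
contributes to the variance. Equality here makes the Poincaré constant sharp. -/
theorem lintegral_crossing_gaussianReal (t : ℝ) :
    ∫⁻ x, ∫⁻ y, ENNReal.ofReal (y - x) * (Set.Iic t).indicator 1 x * (Set.Ioi t).indicator 1 y
      ∂(gaussianReal 0 1) ∂(gaussianReal 0 1) = gaussianPDF 0 1 t := by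
  set γ := gaussianReal 0 1
  have hsplit : ∀ x y : ℝ,
      ENNReal.ofReal (y - x) * (Set.Iic t).indicator 1 x * (Set.Ioi t).indicator 1 y =
        (Set.Iic t).indicator 1 x * ENNReal.ofReal (y - t) +
          ENNReal.ofReal (t - x) * (Set.Ioi t).indicator 1 y := by
    intro x y
    simp only [Set.indicator, Set.mem_Iic, Set.mem_Ioi, Pi.one_apply]
    by_cases h1 : x ≤ t <;> by_cases h2 : t < y
    · simp only [h1, h2, if_true, mul_one, one_mul]
      rw [← ENNReal.ofReal_add (by linarith) (by linarith)]
      congr 1; ring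
    · simp [h1, h2, not_lt.1 h2]
    · simp [h1, h2, (not_le.1 h1).le]
    · simp [h1, h2]
  have hM : ∀ {s : Set ℝ}, MeasurableSet s → Measurable (s.indicator (1 : ℝ → ℝ≥0∞)) :=
    fun hs => measurable_one.indicator hs
  have m1 := hM (measurableSet_Iic (a := t))
  have m2 := hM (measurableSet_Ioi (a := t))
  have hin : ∀ x : ℝ, ∫⁻ y, ((Set.Iic t).indicator 1 x * ENNReal.ofReal (y - t) +
      ENNReal.ofReal (t - x) * (Set.Ioi t).indicator 1 y) ∂γ =
      (Set.Iic t).indicator 1 x * ∫⁻ y, ENNReal.ofReal (y - t) ∂γ +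
        ENNReal.ofReal (t - x) * γ (Set.Ioi t) := by
    intro x
    rw [lintegral_add_left (by fun_prop), lintegral_const_mul _ (by fun_prop),
      lintegral_const_mul _ m2, lintegral_indicator_one measurableSet_Ioi]
  simp_rw [hsplit, hin]
  rw [lintegral_add_left (by fun_prop), lintegral_mul_const _ m1,
    lintegral_mul_const _ (by fun_prop), lintegral_indicator_one measurableSet_Iic,
    ← gaussianReal_kernel t, mul_comm (γ (Set.Ioi t))]

theorem lintegral_symmetrize_swap {X Y : Type*} [MeasurableSpace X] [MeasurableSpace Y]
    (μ : Measure X) (ν : Measure Y) [SFinite μ] [SFinite ν] {k : X → X → Y → ℝ≥0∞}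
    (hk : Measurable fun p : X × X × Y => k p.1 p.2.1 p.2.2) :
    ∫⁻ x, ∫⁻ y, ((∫⁻ t, k x y t ∂ν) + ∫⁻ t, k y x t ∂ν) ∂μ ∂μ =
      2 * ∫⁻ t, ∫⁻ x, ∫⁻ y, k x y t ∂μ ∂μ ∂ν := by
  have hswap : ∫⁻ x, ∫⁻ y, (∫⁻ t, k y x t ∂ν) ∂μ ∂μ = ∫⁻ x, ∫⁻ y, (∫⁻ t, k x y t ∂ν) ∂μ ∂μ :=
    lintegral_lintegral_swap (by fun_prop)
  have hrot : ∫⁻ x, ∫⁻ y, (∫⁻ t, k x y t ∂ν) ∂μ ∂μ = ∫⁻ t, ∫⁻ x, ∫⁻ y, k x y t ∂μ ∂μ ∂ν := by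
    rw [lintegral_lintegral_swap (f := fun t x => ∫⁻ y, k x y t ∂μ) (by fun_prop)]
    refine lintegral_congr fun x => ?_
    rw [lintegral_lintegral_swap (by fun_prop)]
  rw [← hrot, two_mul]
  trans ∫⁻ x, (∫⁻ y, (∫⁻ t, k x y t ∂ν) ∂μ + ∫⁻ y, (∫⁻ t, k y x t ∂ν) ∂μ) ∂μ
  · refine lintegral_congr fun x => ?_
    rw [lintegral_add_left (by fun_prop)]
  · rw [lintegral_add_left (by fun_prop), hswap]

/-- Bound each squared increment by Cauchy–Schwarz and exchange the order of integration: the weight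
received by `(deriv g t) ^ 2` is twice the Gaussian density at `t`. -/
theorem poincareInequality_gaussianReal :
    PoincareInequality (gaussianReal 0 1) fun _ : Unit => (1 : ℝ) := by
  intro g hg
  have hqm : Measurable fun t => ENNReal.ofReal (deriv g t ^ 2) := by
    have := measurable_deriv g; fun_prop
  set k : ℝ → ℝ → ℝ → ℝ≥0∞ := fun x y t =>
    ENNReal.ofReal (y - x) * (Set.Iic t).indicator 1 x * (Set.Ioi t).indicator 1 y *
      ENNReal.ofReal (deriv g t ^ 2) with hk
  have hkm : Measurable fun p : ℝ × ℝ × ℝ => k p.1 p.2.1 p.2.2 := by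
    have h1 : Measurable fun p : ℝ × ℝ × ℝ => (Set.Iic p.2.2).indicator (1 : ℝ → ℝ≥0∞) p.1 :=
      measurable_one.indicator (s := {p : ℝ × ℝ × ℝ | p.1 ≤ p.2.2})
        (measurableSet_le (by fun_prop) (by fun_prop))
    have h2 : Measurable fun p : ℝ × ℝ × ℝ => (Set.Ioi p.2.2).indicator (1 : ℝ → ℝ≥0∞) p.2.1 :=
      measurable_one.indicator (s := {p : ℝ × ℝ × ℝ | p.2.2 < p.2.1})
        (measurableSet_lt (by fun_prop) (by fun_prop))
    simp only [hk]
    fun_prop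
  have hle : ∀ x y, ENNReal.ofReal ((g x - g y) ^ 2) ≤ (∫⁻ t, k x y t) + ∫⁻ t, k y x t := by
    have aux : ∀ x y, x ≤ y → ENNReal.ofReal ((g x - g y) ^ 2) ≤ ∫⁻ t, k x y t := by
      intro x y hxy
      refine (ofReal_sub_sq_le hg hxy).trans_eq ?_
      rw [← setLIntegral_congr (Ico_ae_eq_Ioc (a := x) (b := y)),
        ← lintegral_const_mul _ (by fun_prop), ← lintegral_indicator measurableSet_Ico]
      refine lintegral_congr fun t => ?_
      simp only [hk, Set.indicator, Set.mem_Ico, Set.mem_Iic, Set.mem_Ioi, Pi.one_apply]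
      by_cases h1 : x ≤ t <;> by_cases h2 : t < y <;> simp [h1, h2]
    intro x y
    rcases le_total x y with h | h
    · exact (aux x y h).trans le_self_add
    · rw [sub_sq_comm]
      exact (aux y x h).trans le_add_self
  have hker : ∀ t, ∫⁻ x, ∫⁻ y, k x y t ∂(gaussianReal 0 1) ∂(gaussianReal 0 1) =
      gaussianPDF 0 1 t * ENNReal.ofReal (deriv g t ^ 2) := by
    intro t
    rw [← lintegral_crossing_gaussianReal t]
    have m2 : Measurable ((Set.Ioi t).indicator (1 : ℝ → ℝ≥0∞)) :=
      measurable_one.indicator measurableSet_Ioi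
    have m1 : Measurable ((Set.Iic t).indicator (1 : ℝ → ℝ≥0∞)) :=
      measurable_one.indicator measurableSet_Iic
    rw [← lintegral_mul_const _ (by fun_prop)]
    refine lintegral_congr fun x => ?_
    rw [← lintegral_mul_const _ (by fun_prop)]
  refine (lintegral_mono fun x => lintegral_mono fun y => hle x y).trans_eq ?_
  rw [lintegral_symmetrize_swap _ _ hkm]
  simp_rw [hker, fderiv_apply_one_eq_deriv]
  rw [← lintegral_gaussianReal_zero_one hqm]
  simp

end OneDim

/-! ### Products of standard Gaussians -/

section Pi

/-- Insertion of a coordinate at position `i`, as a continuous linear map. -/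
noncomputable def insertNthCLM {n : ℕ} (i : Fin (n + 1)) :
    ℝ × (Fin n → ℝ) →L[ℝ] (Fin (n + 1) → ℝ) where
  toFun p := i.insertNth (α := fun _ => ℝ) p.1 p.2
  map_add' p q := by simp
  map_smul' c p := by
    ext j
    refine Fin.succAboveCases i ?_ (fun k => ?_) j <;> simp
  cont := Continuous.finInsertNth i continuous_fst continuous_snd

theorem insertNthCLM_apply {n : ℕ} (i : Fin (n + 1)) (p : ℝ × (Fin n → ℝ)) :
    insertNthCLM i p = i.insertNth (α := fun _ => ℝ) p.1 p.2 := rfl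

theorem insertNthCLM_single_self {n : ℕ} (i : Fin (n + 1)) :
    insertNthCLM i (1, 0) = Pi.single i 1 := by
  ext j
  rw [insertNthCLM_apply]
  refine Fin.succAboveCases i ?_ (fun k => ?_) j <;> simp [Fin.succAbove_ne]

theorem insertNthCLM_single_succAbove {n : ℕ} (i : Fin (n + 1)) (k : Fin n) :
    insertNthCLM i (0, Pi.single k 1) = Pi.single (i.succAbove k) 1 := by
  ext j
  rw [insertNthCLM_apply]
  refine Fin.succAboveCases i ?_ (fun l => ?_) j <;>
    simp [Pi.single_apply, (Fin.succAbove_ne i k).symm]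

theorem map_insertNthCLM {n : ℕ} (i : Fin (n + 1)) (ν : Measure ℝ) [IsProbabilityMeasure ν] :
    (ν.prod (Measure.pi fun _ : Fin n => ν)).map (insertNthCLM i) =
      Measure.pi fun _ : Fin (n + 1) => ν :=
  (measurePreserving_piFinSuccAbove (fun _ : Fin (n + 1) => ν) i).symm.map_eq

theorem PoincareInequality.pi {ν : Measure ℝ} [IsProbabilityMeasure ν]
    (h : PoincareInequality ν fun _ : Unit => (1 : ℝ)) (n : ℕ) :
    PoincareInequality (Measure.pi fun _ : Fin n => ν) fun i => Pi.single i (1 : ℝ) := by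
  induction n with
  | zero =>
    intro g _
    have : ∀ x y : Fin 0 → ℝ, g x = g y := fun x y => congrArg g (Subsingleton.elim x y)
    have h0 : ∀ x y : Fin 0 → ℝ, g x - g y = 0 := fun x y => sub_eq_zero.2 (this x y)
    simp [doubledVariance, h0]
  | succ n ih =>
    have key := (h.prod ih).map_affine 0 (insertNthCLM 0)
    simp only [zero_add] at key
    rw [map_insertNthCLM] at key
    intro g hg
    refine (key g hg).trans_eq ?_
    rw [Fintype.sum_sum_type, Fin.sum_univ_succ]
    simp [insertNthCLM_single_self, insertNthCLM_single_succAbove]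

theorem IsSteinPair.pi {ν : Measure ℝ} [IsProbabilityMeasure ν]
    (h : IsSteinPair ν 1 fun x => x) {n : ℕ} (i : Fin n) :
    IsSteinPair (Measure.pi fun _ : Fin n => ν) (Pi.single i 1) fun x => x i := by
  cases n with
  | zero => exact i.elim0
  | succ n =>
    rw [← map_insertNthCLM i, ← insertNthCLM_single_self i]
    refine IsSteinPair.map_linear ?_ (measurable_pi_apply i)
    have := h.prod_left (ν := Measure.pi fun _ : Fin n => ν)
    simpa [insertNthCLM_apply] using this

theorem gradientLowerBound_prod_pi_gaussianReal (n m : ℕ) :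
    GradientLowerBound ((Measure.pi fun _ : Fin n => gaussianReal 0 1).prod
      (Measure.pi fun _ : Fin m => gaussianReal 0 1))
      (Sum.elim (fun i => ((Pi.single i (1 : ℝ), 0) : (Fin n → ℝ) × (Fin m → ℝ)))
        fun j => ((0, Pi.single j (1 : ℝ)) : (Fin n → ℝ) × (Fin m → ℝ))) := by
  have hmem : ∀ {k : ℕ} (i : Fin k), MemLp (fun x : Fin k → ℝ => x i) 2
      (Measure.pi fun _ : Fin k => gaussianReal 0 1) := fun i =>
    (IsGaussian.memLp_two_id (μ := gaussianReal 0 1)).comp_measurePreserving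
      (measurePreserving_eval (fun _ => gaussianReal 0 1) i)
  refine gradientLowerBound_of_isSteinPair (ξ := Sum.elim
    (fun i => (ContinuousLinearMap.proj i).comp (ContinuousLinearMap.fst ℝ _ _))
    (fun j => (ContinuousLinearMap.proj j).comp (ContinuousLinearMap.snd ℝ _ _))) ?_ ?_ ?_
  · rintro (i | j)
    · exact (hmem i).comp_measurePreserving measurePreserving_fst
    · exact (hmem j).comp_measurePreserving measurePreserving_snd
  · rintro (i | i) (j | j) <;> simp [Pi.single_apply]
  · rintro (i | j)
    · exact (isSteinPair_gaussianReal.pi i).prod_left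
    · exact (isSteinPair_gaussianReal.pi j).prod_right

end Pi

/-! ### Multivariate Gaussians -/

section Multivariate

open Matrix

/-- The square root of `S` as a linear map into Euclidean space; up to a translation it transports
a vector of independent standard Gaussians to `multivariateGaussian _ S`. -/
noncomputable def sqrtCLM {n : ℕ} (S : Matrix (Fin n) (Fin n) ℝ) :
    (Fin n → ℝ) →L[ℝ] EuclideanSpace ℝ (Fin n) :=
  (toEuclideanCLM (𝕜 := ℝ) (CFC.sqrt S)).comp
    (EuclideanSpace.equiv (Fin n) ℝ).symm.toContinuousLinearMap

theorem multivariateGaussian_eq_map_pi {n : ℕ} (m : EuclideanSpace ℝ (Fin n))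
    (S : Matrix (Fin n) (Fin n) ℝ) :
    multivariateGaussian m S =
      (Measure.pi fun _ : Fin n => gaussianReal 0 1).map fun x => m + sqrtCLM S x := by
  rw [multivariateGaussian, ← map_pi_eq_stdGaussian, Measure.map_map (by fun_prop) (by fun_prop)]
  rfl

theorem sqrtCLM_single {n : ℕ} (S : Matrix (Fin n) (Fin n) ℝ) (i : Fin n) :
    sqrtCLM S (Pi.single i 1) = ∑ j, CFC.sqrt S j i • EuclideanSpace.single j (1 : ℝ) := by
  ext k
  have : sqrtCLM S (Pi.single i 1) k = (CFC.sqrt S *ᵥ Pi.single i 1) k := rfl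
  rw [this]
  simp [Pi.single_apply]

/-- The columns of the square roots of `S` and `T`, as directions in the two factors. -/
noncomputable def sqrtColumns {n m : ℕ} (S : Matrix (Fin n) (Fin n) ℝ)
    (T : Matrix (Fin m) (Fin m) ℝ) :
    Fin n ⊕ Fin m → EuclideanSpace ℝ (Fin n) × EuclideanSpace ℝ (Fin m) :=
  Sum.elim (fun i => (sqrtCLM S (Pi.single i 1), 0)) fun j => (0, sqrtCLM T (Pi.single j 1))

variable {n m : ℕ} (a : EuclideanSpace ℝ (Fin n)) (b : EuclideanSpace ℝ (Fin m))
  (S : Matrix (Fin n) (Fin n) ℝ) (T : Matrix (Fin m) (Fin m) ℝ)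

theorem multivariateGaussian_prod_eq_map :
    (multivariateGaussian a S).prod (multivariateGaussian b T) =
      ((Measure.pi fun _ : Fin n => gaussianReal 0 1).prod
        (Measure.pi fun _ : Fin m => gaussianReal 0 1)).map
          fun x => (a, b) + (sqrtCLM S).prodMap (sqrtCLM T) x := by
  rw [multivariateGaussian_eq_map_pi, multivariateGaussian_eq_map_pi,
    Measure.map_prod_map _ _ (by fun_prop) (by fun_prop)]
  rfl

theorem sqrtColumns_eq : sqrtColumns S T = fun k => (sqrtCLM S).prodMap (sqrtCLM T)
      (Sum.elim (fun i => ((Pi.single i (1 : ℝ), 0) : (Fin n → ℝ) × (Fin m → ℝ)))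
        (fun j => ((0, Pi.single j (1 : ℝ)) : (Fin n → ℝ) × (Fin m → ℝ))) k) := by
  ext1 (i | j) <;> simp [sqrtColumns]

theorem poincareInequality_multivariateGaussian_prod :
    PoincareInequality ((multivariateGaussian a S).prod (multivariateGaussian b T))
      (sqrtColumns S T) := by
  rw [multivariateGaussian_prod_eq_map, sqrtColumns_eq]
  exact ((poincareInequality_gaussianReal.pi n).prod
    (poincareInequality_gaussianReal.pi m)).map_affine _ _

theorem gradientLowerBound_multivariateGaussian_prod :
    GradientLowerBound ((multivariateGaussian a S).prod (multivariateGaussian b T))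
      (sqrtColumns S T) := by
  rw [multivariateGaussian_prod_eq_map, sqrtColumns_eq]
  exact (gradientLowerBound_prod_pi_gaussianReal n m).map_affine _ _

end Multivariate

/-! ### Quadratic forms of the covariance matrix -/

section Quadratic

open Matrix

variable {n m : ℕ}

theorem sum_sq_sqrt_eq {S : Matrix (Fin n) (Fin n) ℝ} (hS : S.PosSemidef) (p : Fin n → ℝ) :
    ∑ i, (∑ j, CFC.sqrt S j i * p j) ^ 2 = p ⬝ᵥ S *ᵥ p := by
  have hsymm : (CFC.sqrt S)ᵀ = CFC.sqrt S := by
    have := (CFC.sqrt_nonneg S).isSelfAdjoint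
    rwa [IsSelfAdjoint, star_eq_conjTranspose, conjTranspose_eq_transpose_of_trivial] at this
  have h1 : ∑ i, (∑ j, CFC.sqrt S j i * p j) ^ 2 =
      ((CFC.sqrt S)ᵀ *ᵥ p) ⬝ᵥ ((CFC.sqrt S)ᵀ *ᵥ p) := by
    simp [dotProduct, mulVec, sq]
  rw [h1, dotProduct_mulVec, vecMul_transpose, mulVec_mulVec, hsymm,
    CFC.sqrt_mul_sqrt_self _ hS.nonneg, dotProduct_comm]

/-- A positive definite form dominates each squared coordinate; the constant is the squared
Frobenius norm of `S^{-1/2}`. -/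
theorem exists_sq_le_quadraticForm {S : Matrix (Fin n) (Fin n) ℝ} (hS : S.PosDef) :
    ∃ C : ℝ, ∀ (p : Fin n → ℝ) (k : Fin n), p k ^ 2 ≤ C * (p ⬝ᵥ S *ᵥ p) := by
  set R := (CFC.sqrt S)ᵀ with hR
  have hdet : IsUnit R.det := by
    have h1 : (CFC.sqrt S).det * (CFC.sqrt S).det = S.det := by
      rw [← det_mul, CFC.sqrt_mul_sqrt_self _ hS.posSemidef.nonneg]
    have h2 := hS.det_pos
    rw [← h1] at h2
    rw [hR, det_transpose, isUnit_iff_ne_zero]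
    rintro h
    simp [h] at h2
  refine ⟨∑ k, ∑ i, R⁻¹ k i ^ 2, fun p k => ?_⟩
  have hp : p = R⁻¹ *ᵥ (R *ᵥ p) := by
    rw [mulVec_mulVec, nonsing_inv_mul _ hdet, one_mulVec]
  have hq : ∑ i, (R *ᵥ p) i ^ 2 = p ⬝ᵥ S *ᵥ p := by
    rw [← sum_sq_sqrt_eq hS.posSemidef]
    rfl
  have hk : p k = ∑ i, R⁻¹ k i * (R *ᵥ p) i := congrFun hp k
  rw [hk, ← hq]
  refine (Finset.sum_mul_sq_le_sq_mul_sq _ _ _).trans ?_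
  refine mul_le_mul_of_nonneg_right ?_ (Finset.sum_nonneg fun _ _ => sq_nonneg _)
  exact Finset.single_le_sum (f := fun k => ∑ i, R⁻¹ k i ^ 2)
    (fun _ _ => Finset.sum_nonneg fun _ _ => sq_nonneg _) (Finset.mem_univ k)

end Quadratic

/-! ### Variance bounds for functions of two Gaussian vectors -/

section Scalar

open Matrix

variable {n m : ℕ}

/-- The gradient of `g` in its first argument, in coordinates. -/
noncomputable def gradFst (g : EuclideanSpace ℝ (Fin n) × EuclideanSpace ℝ (Fin m) → ℝ)
    (w : EuclideanSpace ℝ (Fin n) × EuclideanSpace ℝ (Fin m)) : Fin n → ℝ :=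
  fun j => fderiv ℝ g w (EuclideanSpace.single j 1, 0)

/-- The gradient of `g` in its second argument, in coordinates. -/
noncomputable def gradSnd (g : EuclideanSpace ℝ (Fin n) × EuclideanSpace ℝ (Fin m) → ℝ)
    (w : EuclideanSpace ℝ (Fin n) × EuclideanSpace ℝ (Fin m)) : Fin m → ℝ :=
  fun j => fderiv ℝ g w (0, EuclideanSpace.single j 1)

@[fun_prop]
theorem measurable_gradFst (g : EuclideanSpace ℝ (Fin n) × EuclideanSpace ℝ (Fin m) → ℝ) :
    Measurable (gradFst g) := measurable_pi_iff.2 fun _ => measurable_fderiv_apply_const ℝ g _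

@[fun_prop]
theorem measurable_gradSnd (g : EuclideanSpace ℝ (Fin n) × EuclideanSpace ℝ (Fin m) → ℝ) :
    Measurable (gradSnd g) := measurable_pi_iff.2 fun _ => measurable_fderiv_apply_const ℝ g _

theorem fderiv_sqrtColumns_inl (g : EuclideanSpace ℝ (Fin n) × EuclideanSpace ℝ (Fin m) → ℝ)
    (w : EuclideanSpace ℝ (Fin n) × EuclideanSpace ℝ (Fin m))
    (S : Matrix (Fin n) (Fin n) ℝ) (T : Matrix (Fin m) (Fin m) ℝ) (i : Fin n) :
    fderiv ℝ g w (sqrtColumns S T (Sum.inl i)) = ∑ j, CFC.sqrt S j i * gradFst g w j := by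
  have h : sqrtColumns S T (Sum.inl i) = ContinuousLinearMap.inl ℝ _ _
    (∑ j, CFC.sqrt S j i • EuclideanSpace.single j (1 : ℝ)) := by
    rw [← sqrtCLM_single]; rfl
  rw [h]
  simp only [map_sum, map_smul, smul_eq_mul]
  rfl

theorem fderiv_sqrtColumns_inr (g : EuclideanSpace ℝ (Fin n) × EuclideanSpace ℝ (Fin m) → ℝ)
    (w : EuclideanSpace ℝ (Fin n) × EuclideanSpace ℝ (Fin m))
    (S : Matrix (Fin n) (Fin n) ℝ) (T : Matrix (Fin m) (Fin m) ℝ) (i : Fin m) :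
    fderiv ℝ g w (sqrtColumns S T (Sum.inr i)) = ∑ j, CFC.sqrt T j i * gradSnd g w j := by
  have h : sqrtColumns S T (Sum.inr i) = ContinuousLinearMap.inr ℝ _ _
    (∑ j, CFC.sqrt T j i • EuclideanSpace.single j (1 : ℝ)) := by
    rw [← sqrtCLM_single]; rfl
  rw [h]
  simp only [map_sum, map_smul, smul_eq_mul]
  rfl

variable {Ω : Type*} [MeasurableSpace Ω] {μ : Measure Ω}
  {a : EuclideanSpace ℝ (Fin n)} {b : EuclideanSpace ℝ (Fin m)}
  {S : Matrix (Fin n) (Fin n) ℝ} {T : Matrix (Fin m) (Fin m) ℝ}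
  {W : Ω → EuclideanSpace ℝ (Fin n) × EuclideanSpace ℝ (Fin m)}
  {g : EuclideanSpace ℝ (Fin n) × EuclideanSpace ℝ (Fin m) → ℝ}

/-- The lower variance bound for a function of two independent Gaussian vectors. -/
theorem quadraticForm_integral_grad_le_variance (hS : S.PosSemidef) (hT : T.PosSemidef)
    (hW : HasLaw W ((multivariateGaussian a S).prod (multivariateGaussian b T)) μ)
    (hg : Differentiable ℝ g) (hg2 : MemLp (fun ω => g (W ω)) 2 μ)
    (h1 : ∀ j, Integrable (fun ω => gradFst g (W ω) j) μ)
    (h2 : ∀ j, Integrable (fun ω => gradSnd g (W ω) j) μ) :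
    (fun j => ∫ ω, gradFst g (W ω) j ∂μ) ⬝ᵥ S *ᵥ (fun j => ∫ ω, gradFst g (W ω) j ∂μ) +
      (fun j => ∫ ω, gradSnd g (W ω) j ∂μ) ⬝ᵥ T *ᵥ (fun j => ∫ ω, gradSnd g (W ω) j ∂μ) ≤
      Var[fun ω => g (W ω); μ] := by
  have hgm := hg.continuous.measurable
  have hm : ∀ k, Measurable fun x => fderiv ℝ g x (sqrtColumns S T k) :=
    fun k => measurable_fderiv_apply_const ℝ g _
  have hint : ∀ k, Integrable (fun ω => fderiv ℝ g (W ω) (sqrtColumns S T k)) μ := by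
    rintro (i | i)
    · simp only [fderiv_sqrtColumns_inl]
      exact integrable_finsetSum _ fun j _ => (h1 j).const_mul _
    · simp only [fderiv_sqrtColumns_inr]
      exact integrable_finsetSum _ fun j _ => (h2 j).const_mul _
  have key := gradientLowerBound_multivariateGaussian_prod a b S T g hg
    (by
      rw [← hW.map_eq]
      exact (memLp_map_measure_iff hgm.aestronglyMeasurable hW.aemeasurable).2 hg2)
    (fun k => by
      rw [← hW.map_eq]
      exact (integrable_map_measure (hm k).aestronglyMeasurable hW.aemeasurable).2 (hint k))
  rw [← hW.map_eq, variance_map hgm.aemeasurable hW.aemeasurable] at key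
  refine le_trans (le_of_eq ?_) key
  rw [← sum_sq_sqrt_eq hS, ← sum_sq_sqrt_eq hT, Fintype.sum_sum_type]
  congr 1
  · refine Finset.sum_congr rfl fun i _ => ?_
    rw [integral_map hW.aemeasurable (hm _).aestronglyMeasurable]
    simp only [fderiv_sqrtColumns_inl]
    rw [integral_finsetSum _ fun j _ => (h1 j).const_mul _]
    simp only [integral_const_mul]
  · refine Finset.sum_congr rfl fun i _ => ?_
    rw [integral_map hW.aemeasurable (hm _).aestronglyMeasurable]
    simp only [fderiv_sqrtColumns_inr]
    rw [integral_finsetSum _ fun j _ => (h2 j).const_mul _]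
    simp only [integral_const_mul]

/-- The Poincaré inequality for a function of two independent Gaussian vectors. Finite energy
forces square integrability. -/
theorem memLp_and_variance_le_integral_quadraticForm_grad (hS : S.PosSemidef) (hT : T.PosSemidef)
    (hW : HasLaw W ((multivariateGaussian a S).prod (multivariateGaussian b T)) μ)
    (hg : Differentiable ℝ g)
    (h : Integrable (fun ω => gradFst g (W ω) ⬝ᵥ S *ᵥ gradFst g (W ω) +
      gradSnd g (W ω) ⬝ᵥ T *ᵥ gradSnd g (W ω)) μ) :
    MemLp (fun ω => g (W ω)) 2 μ ∧ Var[fun ω => g (W ω); μ] ≤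
      ∫ ω, (gradFst g (W ω) ⬝ᵥ S *ᵥ gradFst g (W ω) +
        gradSnd g (W ω) ⬝ᵥ T *ᵥ gradSnd g (W ω)) ∂μ := by
  have hgm := hg.continuous.measurable
  set ρ := (multivariateGaussian a S).prod (multivariateGaussian b T)
  have hm : ∀ k, Measurable fun x => fderiv ℝ g x (sqrtColumns S T k) :=
    fun k => measurable_fderiv_apply_const ℝ g _
  have hnn : ∀ w, 0 ≤ gradFst g w ⬝ᵥ S *ᵥ gradFst g w + gradSnd g w ⬝ᵥ T *ᵥ gradSnd g w := by
    intro w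
    rw [← sum_sq_sqrt_eq hS, ← sum_sq_sqrt_eq hT]
    positivity
  have henergy : ∑ k, ∫⁻ x, ENNReal.ofReal (fderiv ℝ g x (sqrtColumns S T k) ^ 2) ∂ρ =
      ENNReal.ofReal (∫ ω, (gradFst g (W ω) ⬝ᵥ S *ᵥ gradFst g (W ω) +
        gradSnd g (W ω) ⬝ᵥ T *ᵥ gradSnd g (W ω)) ∂μ) := by
    rw [ofReal_integral_eq_lintegral_ofReal h (ae_of_all _ fun ω => hnn (W ω)),
      ← lintegral_finsetSum _ (by fun_prop), ← hW.map_eq,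
      lintegral_map' (by fun_prop) hW.aemeasurable]
    refine lintegral_congr fun ω => ?_
    rw [← ENNReal.ofReal_sum_of_nonneg fun _ _ => sq_nonneg _, Fintype.sum_sum_type,
      ← sum_sq_sqrt_eq hS, ← sum_sq_sqrt_eq hT]
    simp only [fderiv_sqrtColumns_inl, fderiv_sqrtColumns_inr]
  have hP := poincareInequality_multivariateGaussian_prod a b S T g hg
  rw [henergy] at hP
  have hmem : MemLp g 2 ρ := memLp_two_of_doubledVariance_ne_top hgm
    (hP.trans_lt (ENNReal.mul_lt_top (by simp) ENNReal.ofReal_lt_top)).ne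
  rw [doubledVariance_eq_ofReal_variance hmem] at hP
  refine ⟨?_, ?_⟩
  · rw [← hW.map_eq] at hmem
    exact (memLp_map_measure_iff hgm.aestronglyMeasurable hW.aemeasurable).1 hmem
  · have hV : Var[fun ω => g (W ω); μ] = Var[g; ρ] := by
      rw [← hW.map_eq, variance_map hgm.aemeasurable hW.aemeasurable]; rfl
    rw [hV]
    have h0 := integral_nonneg_of_ae (μ := μ) (ae_of_all _ fun ω => hnn (W ω))
    exact (ENNReal.ofReal_le_ofReal_iff h0).1
      ((ENNReal.mul_le_mul_iff_right (by simp) (by simp)).1 hP)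

theorem integrable_of_integrable_quadraticForm [IsFiniteMeasure μ] {p : Ω → Fin n → ℝ} (hS : S.PosDef)
    (hp : ∀ k, AEMeasurable (fun ω => p ω k) μ) {q : Ω → ℝ} (hq : Integrable q μ)
    (hle : ∀ ω, p ω ⬝ᵥ S *ᵥ p ω ≤ q ω) (k : Fin n) : Integrable (fun ω => p ω k) μ := by
  obtain ⟨C, hC⟩ := exists_sq_le_quadraticForm hS
  have h2 : MemLp (fun ω => p ω k) 2 μ := by
    rw [memLp_two_iff_integrable_sq (hp k).aestronglyMeasurable]
    refine (hq.const_mul (max C 0)).mono' ((hp k).pow_const 2).aestronglyMeasurable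
      (ae_of_all _ fun ω => ?_)
    rw [Real.norm_of_nonneg (sq_nonneg _)]
    have h0 : 0 ≤ p ω ⬝ᵥ S *ᵥ p ω := by
      rw [← sum_sq_sqrt_eq hS.posSemidef]
      positivity
    calc p ω k ^ 2 ≤ C * (p ω ⬝ᵥ S *ᵥ p ω) := hC _ _
      _ ≤ max C 0 * (p ω ⬝ᵥ S *ᵥ p ω) := mul_le_mul_of_nonneg_right (le_max_left _ _) h0
      _ ≤ max C 0 * q ω := mul_le_mul_of_nonneg_left (hle ω) (le_max_right _ _)
  exact h2.integrable (by norm_num)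

end Scalar

/-! ### Löwner order, expectations and covariance matrices -/

section Loewner

open Matrix

variable {ι κ : Type*}

theorem Matrix.le_of_dotProduct_mulVec_le [Fintype ι] {A B : Matrix ι ι ℝ} (hA : A.IsHermitian)
    (hB : B.IsHermitian) (h : ∀ a : ι → ℝ, a ⬝ᵥ A *ᵥ a ≤ a ⬝ᵥ B *ᵥ a) : A ≤ B := by
  rw [Matrix.le_iff, posSemidef_iff_dotProduct_mulVec]
  refine ⟨hB.sub hA, fun a => ?_⟩
  rw [star_trivial, sub_mulVec, dotProduct_sub, sub_nonneg]
  exact h a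

theorem dotProduct_mul_mul_transpose_mulVec [Fintype ι] [Fintype κ] (R : Matrix ι κ ℝ) (M : Matrix κ κ ℝ) (a : ι → ℝ) :
    a ⬝ᵥ (R * M * Rᵀ) *ᵥ a = (a ᵥ* R) ⬝ᵥ M *ᵥ (a ᵥ* R) := by
  rw [Matrix.mul_assoc, ← mulVec_mulVec, ← mulVec_mulVec, mulVec_transpose, dotProduct_mulVec]

theorem isHermitian_mul_mul_transpose [Fintype κ] (R : Matrix ι κ ℝ) {M : Matrix κ κ ℝ}
    (hM : M.IsHermitian) : (R * M * Rᵀ).IsHermitian := by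
  simpa [conjTranspose_eq_transpose_of_trivial] using isHermitian_mul_mul_conjTranspose R hM

variable {Ω : Type*} [MeasurableSpace Ω] {μ : Measure Ω}

theorem vecMul_expectation [Fintype ι] {M : Ω → Matrix ι κ ℝ} (hM : HasExpectation μ M) (a : ι → ℝ) :
    a ᵥ* expectation μ M = fun j => ∫ ω, (a ᵥ* M ω) j ∂μ := by
  ext j
  simp only [vecMul, dotProduct, expectation, of_apply]
  rw [integral_finsetSum _ fun i _ => (hM i j).const_mul _]
  simp only [integral_const_mul]

theorem HasExpectation.integrable_vecMul [Fintype ι] {M : Ω → Matrix ι κ ℝ} (hM : HasExpectation μ M)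
    (a : ι → ℝ) (j : κ) : Integrable (fun ω => (a ᵥ* M ω) j) μ := by
  simp only [vecMul, dotProduct]
  exact integrable_finsetSum _ fun i _ => (hM i j).const_mul _

theorem HasExpectation.integrable_quadraticForm [Fintype ι] {M : Ω → Matrix ι ι ℝ} (hM : HasExpectation μ M)
    (a : ι → ℝ) : Integrable (fun ω => a ⬝ᵥ M ω *ᵥ a) μ := by
  simp only [dotProduct_mulVec]
  exact integrable_finsetSum _ fun j _ => (hM.integrable_vecMul a j).mul_const _

theorem HasExpectation.quadraticForm_expectation [Fintype ι] {M : Ω → Matrix ι ι ℝ}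
    (hM : HasExpectation μ M) (a : ι → ℝ) :
    a ⬝ᵥ expectation μ M *ᵥ a = ∫ ω, a ⬝ᵥ M ω *ᵥ a ∂μ := by
  simp only [dotProduct_mulVec, vecMul_expectation hM]
  simp only [dotProduct]
  rw [integral_finsetSum _ fun j _ => (hM.integrable_vecMul a j).mul_const _]
  simp only [integral_mul_const]

theorem isHermitian_expectation {M : Ω → Matrix ι ι ℝ} (hM : ∀ ω, (M ω).IsHermitian) :
    (expectation μ M).IsHermitian := by
  ext i j
  simp only [conjTranspose_apply, expectation, of_apply, star_trivial]
  refine integral_congr_ae (ae_of_all _ fun ω => ?_)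
  simpa using (hM ω).apply i j

theorem isHermitian_covarianceMatrix (Z : Ω → EuclideanSpace ℝ ι) :
    (covarianceMatrix μ Z).IsHermitian := by
  ext i j
  simp only [conjTranspose_apply, covarianceMatrix, of_apply, star_trivial]
  exact covariance_comm _ _

theorem quadraticForm_covarianceMatrix [Fintype ι] [IsProbabilityMeasure μ] {Z : Ω → EuclideanSpace ℝ ι}
    (hZ : ∀ i, MemLp (fun ω => Z ω i) 2 μ) (a : ι → ℝ) :
    a ⬝ᵥ covarianceMatrix μ Z *ᵥ a = Var[fun ω => ∑ i, a i * Z ω i; μ] := by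
  have hm : ∀ i, MemLp (fun ω => a i * Z ω i) 2 μ := fun i => (hZ i).const_mul _
  rw [← covariance_self (memLp_finsetSum _ fun i _ => hm i).aemeasurable,
    covariance_fun_sum_fun_sum hm hm]
  simp only [covariance_const_mul_left, covariance_const_mul_right, dotProduct, mulVec,
    covarianceMatrix, of_apply, Finset.mul_sum]
  refine Finset.sum_congr rfl fun i _ => Finset.sum_congr rfl fun j _ => ?_
  ring

end Loewner

/-! ### Linear combinations of the state and measurement -/

section Measurement

open Matrix

variable {n m : ℕ}

theorem fderiv_apply_eq_jacobian_mulVec {p q : ℕ}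
    (g : EuclideanSpace ℝ (Fin p) → EuclideanSpace ℝ (Fin q)) (x v : EuclideanSpace ℝ (Fin p))
    (i : Fin q) : fderiv ℝ g x v i = (jacobian g x *ᵥ v) i := by
  have hv : v = ∑ j, v j • EuclideanSpace.single j (1 : ℝ) := by
    ext k
    simp [Pi.single_apply]
  conv_lhs => rw [hv]
  simp only [map_sum, map_smul, mulVec, dotProduct, jacobian, of_apply]
  simp [mul_comm]

/-- The linear combination with coefficients `a` of the entries of `(X, h X)`, where
`X = f x + u`, as a function of `w = (x, u)`. This is `aᵀ Z` without the contribution of `V`. -/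
noncomputable def noiselessCombination
    (f : EuclideanSpace ℝ (Fin n) → EuclideanSpace ℝ (Fin n))
    (h : EuclideanSpace ℝ (Fin n) → EuclideanSpace ℝ (Fin m)) (a : Fin n ⊕ Fin m → ℝ)
    (w : EuclideanSpace ℝ (Fin n) × EuclideanSpace ℝ (Fin n)) : ℝ :=
  ∑ i, a (Sum.inl i) * (f w.1 + w.2) i + ∑ j, a (Sum.inr j) * h (f w.1 + w.2) j

variable {f : EuclideanSpace ℝ (Fin n) → EuclideanSpace ℝ (Fin n)}
  {h : EuclideanSpace ℝ (Fin n) → EuclideanSpace ℝ (Fin m)}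

theorem differentiable_noiselessCombination (hf : Differentiable ℝ f) (hh : Differentiable ℝ h)
    (a : Fin n ⊕ Fin m → ℝ) : Differentiable ℝ (noiselessCombination f h a) := by
  unfold noiselessCombination
  fun_prop

theorem fderiv_noiselessCombination_apply (hf : Differentiable ℝ f) (hh : Differentiable ℝ h)
    (a : Fin n ⊕ Fin m → ℝ) (w v : EuclideanSpace ℝ (Fin n) × EuclideanSpace ℝ (Fin n)) :
    fderiv ℝ (noiselessCombination f h a) w v =
      ∑ i, a (Sum.inl i) * (fderiv ℝ f w.1 v.1 + v.2) i +
        ∑ j, a (Sum.inr j) * fderiv ℝ h (f w.1 + w.2) (fderiv ℝ f w.1 v.1 + v.2) j := by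
  have hX : HasFDerivAt
      (fun w : EuclideanSpace ℝ (Fin n) × EuclideanSpace ℝ (Fin n) => f w.1 + w.2)
      ((fderiv ℝ f w.1).comp (ContinuousLinearMap.fst ℝ _ _) +
        ContinuousLinearMap.snd ℝ _ _) w :=
    ((hf w.1).hasFDerivAt.comp w hasFDerivAt_fst).add hasFDerivAt_snd
  have hY := (hh (f w.1 + w.2)).hasFDerivAt.comp w hX
  have hi := fun i : Fin n =>
    ((EuclideanSpace.proj i : EuclideanSpace ℝ (Fin n) →L[ℝ] ℝ).hasFDerivAt.comp w
      hX).const_mul (a (Sum.inl i))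
  have hj := fun j : Fin m =>
    ((EuclideanSpace.proj j : EuclideanSpace ℝ (Fin m) →L[ℝ] ℝ).hasFDerivAt.comp w
      hY).const_mul (a (Sum.inr j))
  have hall := (HasFDerivAt.fun_sum (u := Finset.univ) fun i _ => hi i).add
    (HasFDerivAt.fun_sum (u := Finset.univ) fun j _ => hj j)
  refine (congrArg (fun D => D v) hall.fderiv).trans ?_
  simp [mul_add]

theorem gradFst_noiselessCombination (hf : Differentiable ℝ f) (hh : Differentiable ℝ h)
    (a : Fin n ⊕ Fin m → ℝ) (w : EuclideanSpace ℝ (Fin n) × EuclideanSpace ℝ (Fin n)) :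
    gradFst (noiselessCombination f h a) w =
      a ᵥ* fromRows (jacobian f w.1) (jacobian h (f w.1 + w.2) * jacobian f w.1) := by
  ext k
  rw [gradFst, fderiv_noiselessCombination_apply hf hh a, vecMul_fromRows]
  simp only [add_zero, fderiv_apply_eq_jacobian_mulVec h]
  simp only [vecMul, dotProduct, mulVec, Pi.add_apply, Function.comp_apply, mul_apply]
  rfl

theorem gradSnd_noiselessCombination (hf : Differentiable ℝ f) (hh : Differentiable ℝ h)
    (a : Fin n ⊕ Fin m → ℝ) (w : EuclideanSpace ℝ (Fin n) × EuclideanSpace ℝ (Fin n)) :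
    gradSnd (noiselessCombination f h a) w =
      a ᵥ* fromRows (1 : Matrix (Fin n) (Fin n) ℝ) (jacobian h (f w.1 + w.2)) := by
  ext k
  rw [gradSnd, fderiv_noiselessCombination_apply hf hh a, vecMul_fromRows]
  simp only [map_zero, zero_add, vecMul_one]
  simp [vecMul, dotProduct, jacobian]

end Measurement

/-! ### The matrices of the bounds as quadratic forms -/

section Main

open Matrix

variable {n m : ℕ}
  {f : EuclideanSpace ℝ (Fin n) → EuclideanSpace ℝ (Fin n)}
  {h : EuclideanSpace ℝ (Fin n) → EuclideanSpace ℝ (Fin m)}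

theorem quadraticForm_matCV (SV : Matrix (Fin m) (Fin m) ℝ) (a : Fin n ⊕ Fin m → ℝ) :
    a ⬝ᵥ matCV n SV *ᵥ a = (a ∘ Sum.inr) ⬝ᵥ SV *ᵥ (a ∘ Sum.inr) := by
  rw [matCV, fromBlocks_mulVec]
  simp [dotProduct]

theorem transpose_fromRows_one (M : Matrix (Fin m) (Fin n) ℝ) :
    (fromRows (1 : Matrix (Fin n) (Fin n) ℝ) M)ᵀ = fromCols 1 Mᵀ := by
  rw [transpose_fromRows, transpose_one]

theorem quadraticForm_integrandA₂ {Ω : Type*} {Xp U : Ω → EuclideanSpace ℝ (Fin n)} (hf : Differentiable ℝ f)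
    (hh : Differentiable ℝ h) (Pp SU : Matrix (Fin n) (Fin n) ℝ) (a : Fin n ⊕ Fin m → ℝ) (ω : Ω) :
    a ⬝ᵥ integrandA₂ f h Xp U Pp SU ω *ᵥ a =
      gradFst (noiselessCombination f h a) (Xp ω, U ω) ⬝ᵥ Pp *ᵥ
          gradFst (noiselessCombination f h a) (Xp ω, U ω) +
        gradSnd (noiselessCombination f h a) (Xp ω, U ω) ⬝ᵥ SU *ᵥ
          gradSnd (noiselessCombination f h a) (Xp ω, U ω) := by
  have hF : fromRows (1 : Matrix (Fin n) (Fin n) ℝ) (jacH f h Xp U ω) * jacF f Xp ω =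
      fromRows (jacF f Xp ω) (jacH f h Xp U ω * jacF f Xp ω) := by
    rw [fromRows_mul, Matrix.one_mul]
  rw [integrandA₂, ← transpose_fromRows_one, dotProduct_mul_mul_transpose_mulVec, add_mulVec, dotProduct_add,
    dotProduct_mul_mul_transpose_mulVec, vecMul_vecMul, hF,
    gradFst_noiselessCombination hf hh, gradSnd_noiselessCombination hf hh]
  rfl

theorem sum_mul_jointVar {Ω : Type*} {Xp U : Ω → EuclideanSpace ℝ (Fin n)}
    {V : Ω → EuclideanSpace ℝ (Fin m)} (a : Fin n ⊕ Fin m → ℝ) (ω : Ω) :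
    ∑ i, a i * jointVar f h Xp U V ω i =
      noiselessCombination f h a (Xp ω, U ω) + ∑ j, a (Sum.inr j) * V ω j := by
  rw [Fintype.sum_sum_type]
  simp only [jointVar, noiselessCombination, Sum.elim_inl, Sum.elim_inr, measurementVar, stateVar,
    PiLp.add_apply, mul_add, Finset.sum_add_distrib]
  ring

variable {Ω : Type*} [MeasurableSpace Ω] {μ : Measure Ω}

theorem HasExpectation.fromRows {ι₁ ι₂ κ : Type*} {M : Ω → Matrix ι₁ κ ℝ}
    {N : Ω → Matrix ι₂ κ ℝ} (hM : HasExpectation μ M) (hN : HasExpectation μ N) :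
    HasExpectation μ fun ω => Matrix.fromRows (M ω) (N ω) := by
  rintro (i | i) j
  · exact hM i j
  · exact hN i j

theorem hasExpectation_const [IsFiniteMeasure μ] {ι κ : Type*} (M : Matrix ι κ ℝ) :
    HasExpectation μ fun _ => M := fun _ _ => integrable_const _

theorem quadraticForm_matA₁ {Xp U : Ω → EuclideanSpace ℝ (Fin n)} (hf : Differentiable ℝ f)
    (hh : Differentiable ℝ h) (hF : HasExpectation μ (jacF f Xp))
    (hHF : HasExpectation μ (jacHF f h Xp U)) (Pp : Matrix (Fin n) (Fin n) ℝ)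
    (a : Fin n ⊕ Fin m → ℝ) :
    a ⬝ᵥ matA₁ μ f h Xp U Pp *ᵥ a =
      (fun j => ∫ ω, gradFst (noiselessCombination f h a) (Xp ω, U ω) j ∂μ) ⬝ᵥ Pp *ᵥ
        (fun j => ∫ ω, gradFst (noiselessCombination f h a) (Xp ω, U ω) j ∂μ) := by
  have hE : fromRows (expectation μ (jacF f Xp)) (expectation μ (jacHF f h Xp U)) =
      expectation μ fun ω => fromRows (jacF f Xp ω) (jacHF f h Xp U ω) := by
    ext (i | i) j <;> rfl
  rw [matA₁, ← transpose_fromRows, dotProduct_mul_mul_transpose_mulVec, hE,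
    vecMul_expectation (hF.fromRows hHF)]
  simp only [gradFst_noiselessCombination hf hh]
  rfl

theorem quadraticForm_matB₁ [IsProbabilityMeasure μ] {Xp U : Ω → EuclideanSpace ℝ (Fin n)}
    (hf : Differentiable ℝ f) (hh : Differentiable ℝ h) (hH : HasExpectation μ (jacH f h Xp U))
    (SU : Matrix (Fin n) (Fin n) ℝ) (a : Fin n ⊕ Fin m → ℝ) :
    a ⬝ᵥ matB₁ μ f h Xp U SU *ᵥ a =
      (fun j => ∫ ω, gradSnd (noiselessCombination f h a) (Xp ω, U ω) j ∂μ) ⬝ᵥ SU *ᵥ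
        (fun j => ∫ ω, gradSnd (noiselessCombination f h a) (Xp ω, U ω) j ∂μ) := by
  have hE : fromRows (1 : Matrix (Fin n) (Fin n) ℝ) (expectation μ (jacH f h Xp U)) =
      expectation μ fun ω => fromRows (1 : Matrix (Fin n) (Fin n) ℝ) (jacH f h Xp U ω) := by
    ext (i | i) j
    · simp [expectation]
    · rfl
  rw [matB₁, ← transpose_fromRows_one, dotProduct_mul_mul_transpose_mulVec, hE,
    vecMul_expectation ((hasExpectation_const 1).fromRows hH)]
  simp only [gradSnd_noiselessCombination hf hh]
  rfl

theorem isHermitian_matA₁ (Xp U : Ω → EuclideanSpace ℝ (Fin n)) {Pp : Matrix (Fin n) (Fin n) ℝ}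
    (hPp : Pp.IsHermitian) : (matA₁ μ f h Xp U Pp).IsHermitian := by
  rw [matA₁, ← transpose_fromRows]
  exact isHermitian_mul_mul_transpose _ hPp

theorem isHermitian_matB₁ (Xp U : Ω → EuclideanSpace ℝ (Fin n)) {SU : Matrix (Fin n) (Fin n) ℝ}
    (hSU : SU.IsHermitian) : (matB₁ μ f h Xp U SU).IsHermitian := by
  rw [matB₁, ← transpose_fromRows_one]
  exact isHermitian_mul_mul_transpose _ hSU

theorem isHermitian_matA₂ (Xp U : Ω → EuclideanSpace ℝ (Fin n))
    {Pp SU : Matrix (Fin n) (Fin n) ℝ} (hPp : Pp.IsHermitian) (hSU : SU.IsHermitian) :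
    (matA₂ μ f h Xp U Pp SU).IsHermitian := by
  refine isHermitian_expectation fun ω => ?_
  rw [integrandA₂, ← transpose_fromRows_one]
  exact isHermitian_mul_mul_transpose _ ((isHermitian_mul_mul_transpose _ hPp).add hSU)

theorem isHermitian_matCV {SV : Matrix (Fin m) (Fin m) ℝ} (hSV : SV.IsHermitian) :
    (matCV n SV).IsHermitian := by
  rw [matCV, isHermitian_fromBlocks_iff]
  exact ⟨isHermitian_zero, by simp, by simp, hSV⟩

variable {Xp U : Ω → EuclideanSpace ℝ (Fin n)} {V : Ω → EuclideanSpace ℝ (Fin m)}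
  {SV : Matrix (Fin m) (Fin m) ℝ}

theorem memLp_eval_of_hasLaw_multivariateGaussian {b : EuclideanSpace ℝ (Fin m)}
    (hV : HasLaw V (multivariateGaussian b SV) μ) (j : Fin m) : MemLp (fun ω => V ω j) 2 μ := by
  have h1 : MemLp id 2 (μ.map V) := by
    rw [hV.map_eq]
    exact IsGaussian.memLp_two_id
  exact MemLp.eval_piLp ((memLp_map_measure_iff (by fun_prop) hV.aemeasurable).1 h1) j

theorem covarianceMatrix_of_hasLaw_multivariateGaussian {b : EuclideanSpace ℝ (Fin m)}
    (hSV : SV.PosSemidef) (hV : HasLaw V (multivariateGaussian b SV) μ) :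
    covarianceMatrix μ V = SV := by
  ext i j
  have := covariance_eval_multivariateGaussian (μ := b) hSV i j
  rw [← hV.map_eq, covariance_map_fun (by fun_prop) (by fun_prop) hV.aemeasurable] at this
  exact this

theorem memLp_noiselessCombination_of_jointVar {b : EuclideanSpace ℝ (Fin m)}
    (hV : HasLaw V (multivariateGaussian b SV) μ)
    (hZ : MemLp (jointVar f h Xp U V) 2 μ) (a : Fin n ⊕ Fin m → ℝ) :
    MemLp (fun ω => noiselessCombination f h a (Xp ω, U ω)) 2 μ := by
  have h1 : MemLp (fun ω => ∑ i, a i * jointVar f h Xp U V ω i) 2 μ :=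
    memLp_finsetSum _ fun i _ => (hZ.eval_piLp i).const_mul _
  have h2 : MemLp (fun ω => ∑ j, a (Sum.inr j) * V ω j) 2 μ :=
    memLp_finsetSum _ fun j _ => (memLp_eval_of_hasLaw_multivariateGaussian hV j).const_mul _
  convert h1.sub h2 using 1
  ext ω
  rw [Pi.sub_apply, sum_mul_jointVar, add_sub_cancel_right]

theorem memLp_jointVar_of_noiselessCombination {b : EuclideanSpace ℝ (Fin m)}
    (hV : HasLaw V (multivariateGaussian b SV) μ)
    (hN : ∀ a, MemLp (fun ω => noiselessCombination f h a (Xp ω, U ω)) 2 μ) :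
    MemLp (jointVar f h Xp U V) 2 μ := by
  refine MemLp.of_eval_piLp fun k => ?_
  have h2 : MemLp (fun ω => ∑ j, (Pi.single k 1 : Fin n ⊕ Fin m → ℝ) (Sum.inr j) * V ω j) 2 μ :=
    memLp_finsetSum _ fun j _ => (memLp_eval_of_hasLaw_multivariateGaussian hV j).const_mul _
  convert (hN (Pi.single k 1)).add h2 using 1
  ext ω
  rw [Pi.add_apply, ← sum_mul_jointVar]
  simp [Pi.single_apply]

/-- The measurement noise is independent of the rest and contributes `C_V` additively. -/
theorem quadraticForm_covarianceMatrix_jointVar [IsProbabilityMeasure μ]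
    {b : EuclideanSpace ℝ (Fin m)} (hSV : SV.PosSemidef)
    (hV : HasLaw V (multivariateGaussian b SV) μ)
    (hind : IndepFun (fun ω => (Xp ω, U ω)) V μ) (hf : Differentiable ℝ f)
    (hh : Differentiable ℝ h) (hZ : MemLp (jointVar f h Xp U V) 2 μ) (a : Fin n ⊕ Fin m → ℝ) :
    a ⬝ᵥ covarianceMatrix μ (jointVar f h Xp U V) *ᵥ a =
      Var[fun ω => noiselessCombination f h a (Xp ω, U ω); μ] + a ⬝ᵥ matCV n SV *ᵥ a := by
  have hVj := memLp_eval_of_hasLaw_multivariateGaussian hV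
  have h2 : MemLp (fun ω => ∑ j, a (Sum.inr j) * V ω j) 2 μ :=
    memLp_finsetSum _ fun j _ => (hVj j).const_mul _
  rw [quadraticForm_covarianceMatrix (fun i => hZ.eval_piLp i), quadraticForm_matCV]
  simp only [sum_mul_jointVar]
  have hi : IndepFun (fun ω => noiselessCombination f h a (Xp ω, U ω))
      (fun ω => ∑ j, a (Sum.inr j) * V ω j) μ :=
    hind.comp (φ := noiselessCombination f h a)
      (ψ := fun v : EuclideanSpace ℝ (Fin m) => ∑ j, a (Sum.inr j) * v j)
      (differentiable_noiselessCombination hf hh a).continuous.measurable (by fun_prop)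
  rw [hi.variance_fun_add (memLp_noiselessCombination_of_jointVar hV hZ a) h2]
  congr 1
  rw [← covarianceMatrix_of_hasLaw_multivariateGaussian hSV hV, quadraticForm_covarianceMatrix hVj]
  rfl

end Main

theorem lemma1 {Ω : Type*} [MeasurableSpace Ω] (μ : Measure Ω) [IsProbabilityMeasure μ]
    (n m : ℕ)
    (f : EuclideanSpace ℝ (Fin n) → EuclideanSpace ℝ (Fin n))
    (h : EuclideanSpace ℝ (Fin n) → EuclideanSpace ℝ (Fin m))
    (mp : EuclideanSpace ℝ (Fin n))
    (Pp SU : Matrix (Fin n) (Fin n) ℝ) (SV : Matrix (Fin m) (Fin m) ℝ)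
    (hPp : Pp.PosDef) (hSU : SU.PosDef) (hSV : SV.PosDef)
    (Xp U : Ω → EuclideanSpace ℝ (Fin n)) (V : Ω → EuclideanSpace ℝ (Fin m))
    (hXp : HasLaw Xp (multivariateGaussian mp Pp) μ)
    (hU : HasLaw U (multivariateGaussian 0 SU) μ)
    (hV : HasLaw V (multivariateGaussian 0 SV) μ)
    -- `Xp`, `U`, `V` are mutually independent
    (hXpU : IndepFun Xp U μ) (hXpUV : IndepFun (fun ω => (Xp ω, U ω)) V μ)
    (hf : Differentiable ℝ f) (hh : Differentiable ℝ h) :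
    -- the lower bound holds as soon as `Cov(Z)`, `A₁` and `B₁` exist
    (MemLp (jointVar f h Xp U V) 2 μ →
      HasExpectation μ (jacF f Xp) →
      HasExpectation μ (jacH f h Xp U) →
      HasExpectation μ (jacHF f h Xp U) →
      matA₁ μ f h Xp U Pp + matB₁ μ f h Xp U SU + matCV n SV
        ≤ covarianceMatrix μ (jointVar f h Xp U V)) ∧
    -- if `A₂` exists then so do `Cov(Z)`, `A₁` and `B₁`, and both bounds hold
    (HasExpectation μ (integrandA₂ f h Xp U Pp SU) →
      MemLp (jointVar f h Xp U V) 2 μ ∧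
      HasExpectation μ (jacF f Xp) ∧
      HasExpectation μ (jacH f h Xp U) ∧
      HasExpectation μ (jacHF f h Xp U) ∧
      matA₁ μ f h Xp U Pp + matB₁ μ f h Xp U SU + matCV n SV
        ≤ covarianceMatrix μ (jointVar f h Xp U V) ∧
      covarianceMatrix μ (jointVar f h Xp U V)
        ≤ matA₂ μ f h Xp U Pp SU + matCV n SV) := by
  have hW : HasLaw (fun ω => (Xp ω, U ω))
      ((multivariateGaussian mp Pp).prod (multivariateGaussian 0 SU)) μ := by
    refine ⟨hXp.aemeasurable.prodMk hU.aemeasurable, ?_⟩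
    rw [(indepFun_iff_map_prod_eq_prod_map_map hXp.aemeasurable hU.aemeasurable).1 hXpU,
      hXp.map_eq, hU.map_eq]
  have hCV : (matCV n SV).IsHermitian := isHermitian_matCV hSV.isHermitian
  have hdiff := differentiable_noiselessCombination hf hh
  have lower : MemLp (jointVar f h Xp U V) 2 μ → HasExpectation μ (jacF f Xp) →
      HasExpectation μ (jacH f h Xp U) → HasExpectation μ (jacHF f h Xp U) →
      matA₁ μ f h Xp U Pp + matB₁ μ f h Xp U SU + matCV n SV
        ≤ covarianceMatrix μ (jointVar f h Xp U V) := by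
    intro hZ hF hH hHF
    refine Matrix.le_of_dotProduct_mulVec_le
      (((isHermitian_matA₁ Xp U hPp.isHermitian).add
        (isHermitian_matB₁ Xp U hSU.isHermitian)).add hCV) (isHermitian_covarianceMatrix _)
      fun a => ?_
    rw [Matrix.add_mulVec, Matrix.add_mulVec, dotProduct_add, dotProduct_add,
      quadraticForm_covarianceMatrix_jointVar hSV.posSemidef hV hXpUV hf hh hZ,
      quadraticForm_matA₁ hf hh hF hHF, quadraticForm_matB₁ hf hh hH]
    refine add_le_add_left (quadraticForm_integral_grad_le_variance hPp.posSemidef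
      hSU.posSemidef hW (hdiff a) (memLp_noiselessCombination_of_jointVar hV hZ a)
      (fun j => ?_) fun j => ?_) _
    · simp only [gradFst_noiselessCombination hf hh]
      exact (hF.fromRows hHF).integrable_vecMul a j
    · simp only [gradSnd_noiselessCombination hf hh]
      exact ((hasExpectation_const 1).fromRows hH).integrable_vecMul a j
  refine ⟨lower, fun hA₂ => ?_⟩
  have hint := fun a => hA₂.integrable_quadraticForm a
  simp only [quadraticForm_integrandA₂ hf hh] at hint
  have hpoin := fun a => memLp_and_variance_le_integral_quadraticForm_grad hPp.posSemidef
    hSU.posSemidef hW (hdiff a) (hint a)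
  have hZ : MemLp (jointVar f h Xp U V) 2 μ :=
    memLp_jointVar_of_noiselessCombination hV fun a => (hpoin a).1
  have hFst : ∀ a j, Integrable
      (fun ω => gradFst (noiselessCombination f h a) (Xp ω, U ω) j) μ := fun a j =>
    integrable_of_integrable_quadraticForm hPp
      (fun k => (measurable_pi_iff.1 (measurable_gradFst _) k).comp_aemeasurable hW.aemeasurable)
      (hint a) (fun ω => le_add_of_nonneg_right (by
        simpa using hSU.posSemidef.dotProduct_mulVec_nonneg _)) j
  have hSnd : ∀ a j, Integrable
      (fun ω => gradSnd (noiselessCombination f h a) (Xp ω, U ω) j) μ := fun a j =>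
    integrable_of_integrable_quadraticForm hSU
      (fun k => (measurable_pi_iff.1 (measurable_gradSnd _) k).comp_aemeasurable hW.aemeasurable)
      (hint a) (fun ω => le_add_of_nonneg_left (by
        simpa using hPp.posSemidef.dotProduct_mulVec_nonneg _)) j
  simp only [gradFst_noiselessCombination hf hh] at hFst
  simp only [gradSnd_noiselessCombination hf hh] at hSnd
  -- a basis vector in place of `a` picks out a single row of each Jacobian
  have hF : HasExpectation μ (jacF f Xp) := fun i j => by
    have := hFst (Pi.single (Sum.inl i) 1) j
    simp only [Matrix.single_one_vecMul] at this
    exact this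
  have hHF : HasExpectation μ (jacHF f h Xp U) := fun i j => by
    have := hFst (Pi.single (Sum.inr i) 1) j
    simp only [Matrix.single_one_vecMul] at this
    exact this
  have hH : HasExpectation μ (jacH f h Xp U) := fun i j => by
    have := hSnd (Pi.single (Sum.inr i) 1) j
    simp only [Matrix.single_one_vecMul] at this
    exact this
  refine ⟨hZ, hF, hH, hHF, lower hZ hF hH hHF, ?_⟩
  refine Matrix.le_of_dotProduct_mulVec_le (isHermitian_covarianceMatrix _)
    ((isHermitian_matA₂ Xp U hPp.isHermitian hSU.isHermitian).add hCV) fun a => ?_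
  rw [Matrix.add_mulVec, dotProduct_add,
    quadraticForm_covarianceMatrix_jointVar hSV.posSemidef hV hXpUV hf hh hZ, matA₂,
    hA₂.quadraticForm_expectation]
  simp only [quadraticForm_integrandA₂ hf hh]
  exact add_le_add_left (hpoin a).2 _
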